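/- Let $A\in\mathbb{C}^{n\times n}$ and $B\in\mathbb{C}^{n\times m}$ be such that $(A,B)$ is stabilizable, i.e. there is $F\in\mathbb{C}^{m\times n}$ such that all eigenvalues of $A+BF$ have negative real part. For $x_0\in\mathbb{C}^n$, let $\mathcal{U}(x_0)$ be the set of controls $u\in L^2([0,\infty),\mathbb{C}^m)$ for which the solution $x(t)$ of $\dot x(t)=Ax(t)+Bu(t)$, $x(0)=x_0$, satisfies $\lim_{t\to\infty}x(t)=0$. The infinite-horizon minimum-energy problem is to minimize $\eta(u)=\int_0^\infty\|u(t)\|^2\,dt$ over $u\in\mathcal{U}(x_0)$; it has a solution if the minimum is attained. Let $P\in\mathbb{C}^{n\times n}$ be nonsingular with $P^{-1}AP=\begin{bmatrix}J_u&0\\0&J_s\end{bmatrix}$, where the eigenvalues of $J_u$ have positive real part and those of $J_s$ have nonpositive real part (for instance, a Jordan normal form of $A$ with suitably ordered blocks). Let $C_u$ consist of the rows of $P^{-1}B$ corresponding to the block $J_u$, let $W_u=\int_0^\infty e^{-J_ut}C_uC_u^\dagger e^{-J_u^\dagger t}\,dt$, and put $$K=(P^{-1})^\dagger\begin{bmatrix}W_u^{-1}&0\\0&0\end{bmatrix}P^{-1}$$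 (the integral converges and $W_u$ is nonsingular, so that $K$ is well defined). Let $\mathbf{V}_a\subseteq\mathbb{C}^n$ be the span of the generalized eigenvectors of $A-BB^\dagger K$ for eigenvalues with negative real part. Then, for every $x_0\in\mathbb{C}^n$, the infinite-horizon minimum-energy problem has a solution if and only if $x_0\in\mathbf{V}_a$. In that case the minimal cost is $x_0^\dagger Kx_0$, and there is a unique minimizer $u^*\in\mathcal{U}(x_0)$ (unique up to equality almost everywhere); it is given by the feedback $u^*(t)=-B^\dagger Kx(t)$ for $t\ge 0$, where $x(t)$ is the solution of the system driven by $u^*$ from $x(0)=x_0$. -/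

import Mathlib

open MeasureTheory Filter Topology Set

noncomputable section

namespace MinEnergy

/-- A square complex matrix is Hurwitz if all its eigenvalues have negative real part. -/
def IsHurwitz {k : ℕ} (M : Matrix (Fin k) (Fin k) ℂ) : Prop :=
  ∀ z ∈ spectrum ℂ M, z.re < 0

/-- `(A, B)` is stabilizable if `A + B F` is Hurwitz for some matrix `F`. -/
def Stabilizable {n m : ℕ} (A : Matrix (Fin n) (Fin n) ℂ) (B : Matrix (Fin n) (Fin m) ℂ) : Prop :=
  ∃ F : Matrix (Fin m) (Fin n) ℂ, IsHurwitz (A + B * F)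

/-- `x` is the (Carathéodory) solution on `[0, ∞)` of `x' = A x + B u`, `x 0 = x₀`: it is
continuous and satisfies the integrated equation. Only the values at times `t ≥ 0` matter. -/
def IsTrajectory {n m : ℕ} (A : Matrix (Fin n) (Fin n) ℂ) (B : Matrix (Fin n) (Fin m) ℂ)
    (x₀ : Fin n → ℂ) (u : ℝ → EuclideanSpace ℂ (Fin m)) (x : ℝ → Fin n → ℂ) : Prop :=
  ContinuousOn x (Ici 0) ∧
    ∀ t : ℝ, 0 ≤ t → x t = x₀ + ∫ s in (0 : ℝ)..t, (A.mulVec (x s) + B.mulVec (u s).ofLp)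

/-- The set of admissible controls: square-integrable on `[0, ∞)`, with trajectory from `x₀`
tending to `0`. -/
def admissible {n m : ℕ} (A : Matrix (Fin n) (Fin n) ℂ) (B : Matrix (Fin n) (Fin m) ℂ)
    (x₀ : Fin n → ℂ) : Set (ℝ → EuclideanSpace ℂ (Fin m)) :=
  {u | MemLp u 2 (volume.restrict (Ici 0)) ∧
    ∃ x : ℝ → Fin n → ℂ, IsTrajectory A B x₀ u x ∧ Tendsto x atTop (𝓝 0)}

/-- The energy `∫₀^∞ ‖u(t)‖² dt` (Euclidean norm). -/
def energy {m : ℕ} (u : ℝ → EuclideanSpace ℂ (Fin m)) : ℝ :=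
  ∫ t in Ici (0 : ℝ), ‖u t‖ ^ 2

/-- `u` solves the infinite-horizon minimum energy control problem from `x₀`. -/
def IsMinimizer {n m : ℕ} (A : Matrix (Fin n) (Fin n) ℂ) (B : Matrix (Fin n) (Fin m) ℂ)
    (x₀ : Fin n → ℂ) (u : ℝ → EuclideanSpace ℂ (Fin m)) : Prop :=
  u ∈ admissible A B x₀ ∧ ∀ v ∈ admissible A B x₀, energy u ≤ energy v

/-- A change of coordinates `P` such that `P⁻¹ A P` is block diagonal (after labelling the
coordinates by `Fin nu ⊕ Fin ns`) with blocks `Ju`, whose eigenvalues have positive real part, and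
`Js`, whose eigenvalues have nonpositive real part. A Jordan normal form of `A` with its blocks
suitably ordered is one. -/
structure SpectralSplitting {n : ℕ} (A : Matrix (Fin n) (Fin n) ℂ) where
  nu : ℕ
  ns : ℕ
  e : Fin nu ⊕ Fin ns ≃ Fin n
  P : Matrix (Fin n) (Fin n) ℂ
  Ju : Matrix (Fin nu) (Fin nu) ℂ
  Js : Matrix (Fin ns) (Fin ns) ℂ
  isUnit_P : IsUnit P
  conj_eq : P⁻¹ * A * P = Matrix.reindex e e (Matrix.fromBlocks Ju 0 0 Js)
  re_pos : ∀ z ∈ spectrum ℂ Ju, 0 < z.re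
  re_nonpos : ∀ z ∈ spectrum ℂ Js, z.re ≤ 0

theorem spectralSplitting_of_isCompl {n : ℕ} (A : Matrix (Fin n) (Fin n) ℂ)
    (f : Module.End ℂ (Fin n → ℂ)) (hf : f = Matrix.toLin' A) (U V : Submodule ℂ (Fin n → ℂ))
    (hc : IsCompl U V) (hU : ∀ v ∈ U, f v ∈ U) (hV : ∀ v ∈ V, f v ∈ V)
    (hpos : ∀ z : ℂ, ∀ v ∈ U, v ≠ 0 → f v = z • v → 0 < z.re)
    (hneg : ∀ z : ℂ, ∀ v ∈ V, v ≠ 0 → f v = z • v → z.re ≤ 0) :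
    Nonempty (SpectralSplitting A) := by
  obtain ⟨bU⟩ : Nonempty (Module.Basis (Fin (Module.finrank ℂ U)) ℂ U) := ⟨Module.finBasis ℂ U⟩
  obtain ⟨bV⟩ : Nonempty (Module.Basis (Fin (Module.finrank ℂ V)) ℂ V) := ⟨Module.finBasis ℂ V⟩
  obtain ⟨b, hl, hr, hrl, hrr⟩ : ∃ b : Module.Basis
      (Fin (Module.finrank ℂ U) ⊕ Fin (Module.finrank ℂ V)) ℂ (Fin n → ℂ),
      (∀ i, b (Sum.inl i) = bU i) ∧ (∀ i, b (Sum.inr i) = bV i) ∧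
      (∀ w : U, b.repr (w : Fin n → ℂ) = (bU.prod bV).repr (w, 0)) ∧
      (∀ w : V, b.repr (w : Fin n → ℂ) = (bU.prod bV).repr (0, w)) := by
    refine ⟨(bU.prod bV).map (Submodule.prodEquivOfIsCompl _ _ hc), ?_, ?_, ?_, ?_⟩
    · intro i; simp
    · intro i; simp
    · intro w
      have h : (w : Fin n → ℂ) = Submodule.prodEquivOfIsCompl _ _ hc (w, 0) := by simp
      rw [h, Module.Basis.map_repr, LinearEquiv.trans_apply, LinearEquiv.symm_apply_apply]
    · intro w
      have h : (w : Fin n → ℂ) = Submodule.prodEquivOfIsCompl _ _ hc (0, w) := by simp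
      rw [h, Module.Basis.map_repr, LinearEquiv.trans_apply, LinearEquiv.symm_apply_apply]
  have hPQ : (Pi.basisFun ℂ (Fin n)).toMatrix (b.reindex (b.indexEquiv (Pi.basisFun ℂ (Fin n)))) *
      (b.reindex (b.indexEquiv (Pi.basisFun ℂ (Fin n)))).toMatrix (Pi.basisFun ℂ (Fin n)) = 1 :=
    Module.Basis.toMatrix_mul_toMatrix_flip _ _
  have hQP : (b.reindex (b.indexEquiv (Pi.basisFun ℂ (Fin n)))).toMatrix (Pi.basisFun ℂ (Fin n)) *
      (Pi.basisFun ℂ (Fin n)).toMatrix (b.reindex (b.indexEquiv (Pi.basisFun ℂ (Fin n)))) = 1 :=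
    Module.Basis.toMatrix_mul_toMatrix_flip _ _
  generalize b.indexEquiv (Pi.basisFun ℂ (Fin n)) = e at hPQ hQP
  refine ⟨⟨_, _, e, (Pi.basisFun ℂ (Fin n)).toMatrix (b.reindex e),
    LinearMap.toMatrix bU bU (f.restrict hU), LinearMap.toMatrix bV bV (f.restrict hV),
    ⟨⟨_, _, hPQ, hQP⟩, rfl⟩, ?_, ?_, ?_⟩⟩
  · have hA : A = LinearMap.toMatrix (Pi.basisFun ℂ (Fin n)) (Pi.basisFun ℂ (Fin n)) f := by
      rw [hf, LinearMap.toMatrix_eq_toMatrix', LinearMap.toMatrix'_toLin']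
    rw [Matrix.inv_eq_left_inv hQP]
    conv_lhs => rw [hA]
    rw [basis_toMatrix_mul_linearMap_toMatrix_mul_basis_toMatrix]
    have hfl : ∀ i, f (bU i : Fin n → ℂ) = (f.restrict hU (bU i) : U) := fun i => rfl
    have hfr : ∀ i, f (bV i : Fin n → ℂ) = (f.restrict hV (bV i) : V) := fun i => rfl
    ext i j
    obtain ⟨i, rfl⟩ := e.surjective i
    obtain ⟨j, rfl⟩ := e.surjective j
    rw [LinearMap.toMatrix_apply]
    simp only [Module.Basis.repr_reindex, Module.Basis.reindex_apply,
      Equiv.symm_apply_apply, Finsupp.mapDomain_equiv_apply, Matrix.reindex_apply,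
      Matrix.submatrix_apply]
    rcases j with j | j
    · rw [hl, hfl, hrl]
      rcases i with i | i <;> simp [LinearMap.toMatrix_apply]
    · rw [hr, hfr, hrr]
      rcases i with i | i <;> simp [LinearMap.toMatrix_apply]
  · intro z hz
    rw [LinearMap.spectrum_toMatrix, ← Module.End.hasEigenvalue_iff_mem_spectrum] at hz
    obtain ⟨v, hv⟩ := hz.exists_hasEigenvector
    exact hpos z v v.2 (fun h => hv.2 (Subtype.ext h)) (congrArg Subtype.val hv.apply_eq_smul)
  · intro z hz
    rw [LinearMap.spectrum_toMatrix, ← Module.End.hasEigenvalue_iff_mem_spectrum] at hz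
    obtain ⟨v, hv⟩ := hz.exists_hasEigenvector
    exact hneg z v v.2 (fun h => hv.2 (Subtype.ext h)) (congrArg Subtype.val hv.apply_eq_smul)

/-- Every complex matrix has a spectral splitting. -/
theorem nonempty_spectralSplitting {n : ℕ} (A : Matrix (Fin n) (Fin n) ℂ) :
    Nonempty (SpectralSplitting A) := by
  obtain ⟨f, hf⟩ : ∃ f : Module.End ℂ (Fin n → ℂ), f = Matrix.toLin' A := ⟨_, rfl⟩
  have hmem : ∀ (s : Set ℂ) (z : ℂ), z ∈ s →
      f.maxGenEigenspace z ≤ ⨆ z ∈ s, f.maxGenEigenspace z := fun s z hz =>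
    le_iSup₂ (f := fun z (_ : z ∈ s) => f.maxGenEigenspace z) z hz
  have hinv : ∀ s : Set ℂ, ∀ v ∈ ⨆ z ∈ s, f.maxGenEigenspace z,
      f v ∈ ⨆ z ∈ s, f.maxGenEigenspace z := by
    intro s
    have h : (⨆ z ∈ s, f.maxGenEigenspace z) ≤ (⨆ z ∈ s, f.maxGenEigenspace z).comap f :=
      iSup₂_le fun z hz v hv => hmem s z hz
        (Module.End.mapsTo_maxGenEigenspace_of_comm (Commute.refl f) z hv)
    exact h
  have hdisj : ∀ s t : Set ℂ, Disjoint s t →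
      Disjoint (⨆ z ∈ s, f.maxGenEigenspace z) (⨆ z ∈ t, f.maxGenEigenspace z) := fun s t hst =>
    f.independent_maxGenEigenspace.disjoint_biSup_biSup hst
  have hspec : ∀ s : Set ℂ, ∀ z, ∀ v ∈ ⨆ z ∈ s, f.maxGenEigenspace z, v ≠ 0 → f v = z • v →
      z ∈ s := by
    intro s z v hv h0 hz
    by_contra hzs
    have h1 : v ∈ f.maxGenEigenspace z :=
      Module.End.eigenspace_le_maxGenEigenspace (Module.End.mem_eigenspace_iff.2 hz)
    exact h0 (Submodule.disjoint_def.1 (f.independent_maxGenEigenspace.disjoint_biSup hzs) v h1 hv)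
  refine spectralSplitting_of_isCompl A f hf _ _ (IsCompl.mk (hdisj {z | 0 < z.re} {z | z.re ≤ 0} ?_)
    ?_) (hinv _) (hinv _) (hspec _) (hspec _)
  · rw [Set.disjoint_left]
    exact fun z (h1 : 0 < z.re) (h2 : z.re ≤ 0) => absurd h1 (not_lt.2 h2)
  · rw [codisjoint_iff, eq_top_iff, ← Module.End.iSup_maxGenEigenspace_eq_top f]
    refine iSup_le fun z => ?_
    by_cases hz : 0 < z.re
    · exact (hmem {z | 0 < z.re} z hz).trans le_sup_left
    · exact (hmem {z | z.re ≤ 0} z (not_lt.1 hz)).trans le_sup_right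

/-- The integrand `e^{-J t} C C† e^{-J† t}` of the controllability Gramian. -/
def gramianIntegrand {k m : ℕ} (J : Matrix (Fin k) (Fin k) ℂ) (C : Matrix (Fin k) (Fin m) ℂ)
    (t : ℝ) : Matrix (Fin k) (Fin k) ℂ :=
  NormedSpace.exp ((-t) • J) * C * C.conjTranspose * NormedSpace.exp ((-t) • J.conjTranspose)

/-- The infinite-horizon Gramian `∫₀^∞ e^{-J t} C C† e^{-J† t} dt`, entry by entry. -/
def gramianInfty {k m : ℕ} (J : Matrix (Fin k) (Fin k) ℂ) (C : Matrix (Fin k) (Fin m) ℂ) :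
    Matrix (Fin k) (Fin k) ℂ :=
  Matrix.of fun i j => ∫ t in Ici (0 : ℝ), gramianIntegrand J C t i j

namespace SpectralSplitting

variable {n m : ℕ} {A : Matrix (Fin n) (Fin n) ℂ}

/-- The rows of `P⁻¹ B` that belong to the block `Ju`. -/
def Cu (S : SpectralSplitting A) (B : Matrix (Fin n) (Fin m) ℂ) : Matrix (Fin S.nu) (Fin m) ℂ :=
  (S.P⁻¹ * B).submatrix (fun i => S.e (Sum.inl i)) id

/-- The Gramian `Wu` of `(Ju, Cu)` on `[0, ∞)`. -/
def Wu (S : SpectralSplitting A) (B : Matrix (Fin n) (Fin m) ℂ) :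
    Matrix (Fin S.nu) (Fin S.nu) ℂ :=
  gramianInfty S.Ju (S.Cu B)

/-- `K = (P⁻¹)† diag(Wu⁻¹, 0) P⁻¹`. -/
def K (S : SpectralSplitting A) (B : Matrix (Fin n) (Fin m) ℂ) : Matrix (Fin n) (Fin n) ℂ :=
  (S.P⁻¹).conjTranspose *
    Matrix.reindex S.e S.e (Matrix.fromBlocks (S.Wu B)⁻¹ 0 0 0) * S.P⁻¹

end SpectralSplitting

/-- The span of the generalized eigenvectors of `M` for the eigenvalues with negative real part. -/
def stableSubspace {n : ℕ} (M : Matrix (Fin n) (Fin n) ℂ) : Submodule ℂ (Fin n → ℂ) :=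
  ⨆ z : {z : ℂ // z.re < 0}, Module.End.maxGenEigenspace (Matrix.toLin' M) z.1

end MinEnergy

end

/-! The matrix `K` is Hermitian and solves the Riccati equation A†K + KA = KBB†K: with T the
unstable rows of P⁻¹ one has TA = J_u T and K = T†W_u⁻¹T, and the equation is the Lyapunov equation
J_u W + W J_u† = C_u C_u† for W = W_u, multiplied by W⁻¹ on both sides (`riccati`). Along a
trajectory the derivative of x†Kx is therefore ‖u + B†Kx‖² − ‖u‖². If x tends to 0, integration
shows that the energy of u equals x₀†Kx₀ plus the integral of ‖u + B†Kx‖²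
(`tendsto_integral_deviation`). So x₀†Kx₀ is a lower bound, attained exactly when u = −B†Kx almost
everywhere. In that case x is the closed-loop flow, and this flow tends to 0 exactly when x₀ lies in
the stable subspace (`mem_stableSubspace_of_tendsto`).

What remains is that no minimizer exists for the other x₀. This needs the infimum of the energy to
equal x₀†Kx₀ for every x₀, attained or not (`optimalCost_le_quadratic_form`). Split x₀ = v + r into
closed-loop stable and antistable parts. The matrix W⁻¹T intertwines A − BB†K with −J_u†, all of
whose eigenvalues have negative real part; hence Tr = 0, so that Kr = 0 and r is a sum of
generalized eigenvectors of A for eigenvalues with nonpositive real part. Such an r can be steered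
to 0 with arbitrarily small energy, so x₀ costs no more than v, which costs v†Kv = x₀†Kx₀.

The zero cost of r needs no controllability estimate. Let V denote the infimal cost. It is
quadratically homogeneous, so V(2y) = 4V(y). If waiting never raises the cost of y, one copy of y
can be steered now and the other after a long delay, when the first control has almost died out;
this gives V(2y) ≤ 2V(y), hence V(y) = 0 (`optimalCost_eq_zero_of_flow_le`). Induction on the order
of a generalized eigenvector supplies the monotonicity: after a wait T the leading term is e^{zT}y
with |e^{zT}| ≤ 1, and the other terms have lower order and cost nothing. -/

noncomputable section

open scoped Matrix

namespace MinEnergy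

/-! ### Linear flows, exponential decay and the stable subspace -/

section

variable {n m k : ℕ}

/-- The linear flow `e^{tM} v`. -/
def flow (M : Matrix (Fin n) (Fin n) ℂ) (t : ℝ) (v : Fin n → ℂ) : Fin n → ℂ :=
  NormedSpace.exp (t • M) *ᵥ v

@[simp] theorem flow_zero (M : Matrix (Fin n) (Fin n) ℂ) (v : Fin n → ℂ) : flow M 0 v = v := by
  simp [flow]

theorem flow_add_vec (M : Matrix (Fin n) (Fin n) ℂ) (t : ℝ) (v w : Fin n → ℂ) :
    flow M t (v + w) = flow M t v + flow M t w := Matrix.mulVec_add _ _ _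

theorem flow_smul_vec (M : Matrix (Fin n) (Fin n) ℂ) (t : ℝ) (c : ℂ) (v : Fin n → ℂ) :
    flow M t (c • v) = c • flow M t v := Matrix.mulVec_smul _ _ _

theorem commute_exp_smul (M : Matrix (Fin n) (Fin n) ℂ) (t : ℝ) :
    Commute M (NormedSpace.exp (t • M)) :=
  ((Commute.refl M).smul_right t).exp_right

theorem mulVec_flow (M : Matrix (Fin n) (Fin n) ℂ) (t : ℝ) (v : Fin n → ℂ) :
    M *ᵥ flow M t v = flow M t (M *ᵥ v) := by
  simp only [flow, Matrix.mulVec_mulVec, (commute_exp_smul M t).eq]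

section
open scoped Matrix.Norms.Operator

theorem hasDerivAt_exp_smul (M : Matrix (Fin n) (Fin n) ℂ) (t : ℝ) :
    HasDerivAt (fun s : ℝ => NormedSpace.exp (s • M)) (M * NormedSpace.exp (t • M)) t :=
  hasDerivAt_exp_smul_const' (𝕂 := ℝ) M t

theorem hasDerivAt_flow (M : Matrix (Fin n) (Fin n) ℂ) (v : Fin n → ℂ) (t : ℝ) :
    HasDerivAt (fun s => flow M s v) (M *ᵥ flow M t v) t := by
  let L : Matrix (Fin n) (Fin n) ℂ →L[ℝ] (Fin n → ℂ) :=
    LinearMap.toContinuousLinearMap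
      ((Matrix.mulVecBilin ℝ ℝ).flip v)
  have h := L.hasFDerivAt.comp_hasDerivAt t (hasDerivAt_exp_smul M t)
  have e : M *ᵥ flow M t v = L (M * NormedSpace.exp (t • M)) := by
    simp [L, flow, Matrix.mulVec_mulVec]
  rw [e]
  exact h

theorem hasSum_flow (M : Matrix (Fin n) (Fin n) ℂ) (v : Fin n → ℂ) (t : ℝ) :
    HasSum (fun j : ℕ => ((j.factorial : ℝ)⁻¹ * t ^ j) • (M ^ j *ᵥ v)) (flow M t v) := by
  let L : Matrix (Fin n) (Fin n) ℂ →L[ℝ] (Fin n → ℂ) :=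
    LinearMap.toContinuousLinearMap
      ((Matrix.mulVecBilin ℝ ℝ).flip v)
  have h := L.hasSum (NormedSpace.exp_series_hasSum_exp' (𝕂 := ℝ) (t • M))
  convert h using 1
  · ext1 j
    simp [L, smul_pow, mul_smul]
  · rfl

end

theorem continuous_flow (M : Matrix (Fin n) (Fin n) ℂ) (v : Fin n → ℂ) :
    Continuous (fun t => flow M t v) :=
  continuous_iff_continuousAt.2 fun t => (hasDerivAt_flow M v t).continuousAt

theorem flow_eq_integral (M : Matrix (Fin n) (Fin n) ℂ) (v : Fin n → ℂ) (t : ℝ) :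
    flow M t v = v + ∫ s in (0 : ℝ)..t, M *ᵥ flow M s v := by
  rw [intervalIntegral.integral_eq_sub_of_hasDerivAt (fun s _ => hasDerivAt_flow M v s)]
  · simp
  · exact (Continuous.matrix_mulVec continuous_const (continuous_flow M v)).intervalIntegrable _ _

theorem lipschitzWith_mulVec (M : Matrix (Fin n) (Fin n) ℂ) :
    ∃ c : NNReal, LipschitzWith c (fun v : Fin n → ℂ => M *ᵥ v) :=
  ⟨_, (LinearMap.toContinuousLinearMap (Matrix.toLin' M)).lipschitz⟩

/-- Solutions of the linear integral equation are given by the flow. -/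
theorem eq_flow_of_integral_eq (M : Matrix (Fin n) (Fin n) ℂ) (v : Fin n → ℂ)
    (x : ℝ → Fin n → ℂ) (hx : ContinuousOn x (Ici 0))
    (h : ∀ t, 0 ≤ t → x t = v + ∫ s in (0 : ℝ)..t, M *ᵥ x s) {t : ℝ} (ht : 0 ≤ t) :
    x t = flow M t v := by
  -- Freezing x at negative times makes it continuous on the whole line, so its primitive is
  -- differentiable everywhere, endpoint 0 included.
  let y : ℝ → Fin n → ℂ := fun s => x (max s 0)
  have hy : Continuous y := by
    refine hx.comp_continuous (by fun_prop) fun s => mem_Ici.2 (le_max_right _ _)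
  let z : ℝ → Fin n → ℂ := fun t => v + ∫ s in (0 : ℝ)..t, M *ᵥ y s
  have hzd : ∀ s, HasDerivAt z (M *ᵥ y s) s := fun s =>
    ((Continuous.matrix_mulVec continuous_const hy).integral_hasStrictDerivAt 0 s).hasDerivAt.const_add v
  have hxz : ∀ s, 0 ≤ s → y s = z s := by
    intro s hs
    simp only [y, z, max_eq_left hs]
    rw [h s hs]
    congr 1
    refine intervalIntegral.integral_congr fun r hr => ?_
    rw [uIcc_of_le hs] at hr
    simp [max_eq_left hr.1]
  obtain ⟨c, hc⟩ := lipschitzWith_mulVec M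
  have key : EqOn z (fun s => flow M s v) (Icc 0 t) := by
    refine ODE_solution_unique_of_mem_Icc_right (v := fun _ w => M *ᵥ w) (s := fun _ => univ)
      (K := c) (fun _ _ => hc.lipschitzOnWith)
      (fun s _ => (hzd s).continuousAt.continuousWithinAt) (fun s hs => ?_) (fun _ _ => mem_univ _)
      (continuous_flow M v).continuousOn (fun s _ => (hasDerivAt_flow M v s).hasDerivWithinAt)
      (fun _ _ => mem_univ _) (by simp [z])
    have := (hzd s).hasDerivWithinAt (s := Ici s)
    rwa [hxz s hs.1] at this
  have h1 := key ⟨ht, le_rfl⟩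
  have h2 := hxz t ht
  simp only [y, max_eq_left ht] at h2
  rw [h2, h1]

theorem flow_sub_smul_one (M : Matrix (Fin n) (Fin n) ℂ) (z : ℂ) (v : Fin n → ℂ) (t : ℝ) :
    flow M t v = Complex.exp (t * z) • flow (M - z • 1) t v := by
  have hc : Commute (t • (z • (1 : Matrix (Fin n) (Fin n) ℂ))) (t • (M - z • 1)) :=
    (((Commute.one_left _).smul_left z).smul_left t).smul_right t
  have h1 : t • M = t • (z • (1 : Matrix (Fin n) (Fin n) ℂ)) + t • (M - z • 1) := by
    rw [← smul_add]; congr 1; abel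
  have h2 : t • (z • (1 : Matrix (Fin n) (Fin n) ℂ)) = Matrix.diagonal (fun _ => (t : ℂ) * z) := by
    rw [Matrix.smul_one_eq_diagonal]
    ext i j
    by_cases hij : i = j <;> simp [Matrix.diagonal, hij]
  rw [flow, h1, Matrix.exp_add_of_commute _ _ hc, h2, Matrix.exp_diagonal, ← Matrix.mulVec_mulVec]
  ext i
  simp [Matrix.mulVec_diagonal, flow, Complex.exp_eq_exp_ℂ]

theorem mem_genEigenspace_toLin' {M : Matrix (Fin n) (Fin n) ℂ} {z : ℂ} {k : ℕ} {v : Fin n → ℂ} :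
    v ∈ Module.End.genEigenspace (Matrix.toLin' M) z k ↔ (M - z • 1) ^ k *ᵥ v = 0 := by
  rw [Module.End.mem_genEigenspace_nat, LinearMap.mem_ker]
  have : Matrix.toLin' M - z • 1 = Matrix.toLin' (M - z • 1) := by simp [Module.End.one_eq_id]
  rw [this, ← Matrix.toLin'_pow, Matrix.toLin'_apply]

theorem mem_maxGenEigenspace_toLin' {M : Matrix (Fin n) (Fin n) ℂ} {z : ℂ} {v : Fin n → ℂ} :
    v ∈ Module.End.maxGenEigenspace (Matrix.toLin' M) z ↔
      ∃ k : ℕ, (M - z • 1) ^ k *ᵥ v = 0 := by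
  rw [Module.End.mem_maxGenEigenspace]
  refine exists_congr fun k => ?_
  rw [← mem_genEigenspace_toLin', Module.End.mem_genEigenspace_nat, LinearMap.mem_ker]

/-- On generalized eigenvectors the flow is an exponential times a polynomial. -/
theorem flow_eq_sum {M : Matrix (Fin n) (Fin n) ℂ} {z : ℂ} {k : ℕ} {v : Fin n → ℂ}
    (hv : (M - z • 1) ^ k *ᵥ v = 0) (t : ℝ) :
    flow M t v = Complex.exp (t * z) •
      ∑ j ∈ Finset.range k, ((j.factorial : ℝ)⁻¹ * t ^ j) • ((M - z • 1) ^ j *ᵥ v) := by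
  rw [flow_sub_smul_one M z]
  congr 1
  refine (hasSum_flow _ _ _).unique (hasSum_sum_of_ne_finset_zero fun j hj => ?_)
  obtain ⟨i, rfl⟩ := Nat.exists_eq_add_of_le (not_lt.1 (fun h => hj (Finset.mem_range.2 h)))
  rw [add_comm, pow_add (M - z • 1), ← Matrix.mulVec_mulVec, hv]
  simp

/-- `e^{tM} v` decays exponentially. -/
def ExpDecay (M : Matrix (Fin n) (Fin n) ℂ) (v : Fin n → ℂ) : Prop :=
  ∃ c > 0, ∃ C, ∀ t : ℝ, 0 ≤ t → ‖flow M t v‖ ≤ C * Real.exp (-c * t)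

/-- Half of the rate −Re z is spent on the polynomial factor: with d = −Re z / 2, t^j / j! ≤ d^{-j}
e^{dt}, and e^{-dt} is left over. -/
theorem expDecay_of_pow_mulVec_eq_zero {M : Matrix (Fin n) (Fin n) ℂ} {z : ℂ} (hz : z.re < 0)
    {k : ℕ} {v : Fin n → ℂ} (hv : (M - z • 1) ^ k *ᵥ v = 0) : ExpDecay M v := by
  refine ⟨-z.re / 2, by linarith, ∑ j ∈ Finset.range k,
    (-z.re / 2)⁻¹ ^ j * ‖(M - z • 1) ^ j *ᵥ v‖, fun t ht => ?_⟩
  have hd : 0 < -z.re / 2 := by linarith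
  rw [flow_eq_sum hv, norm_smul, Complex.norm_exp]
  have h1 : ((t : ℂ) * z).re = -(-z.re / 2) * t + -((-z.re / 2) * t) := by
    rw [Complex.re_ofReal_mul]; ring
  rw [h1, Real.exp_add, mul_assoc, mul_comm]
  refine mul_le_mul_of_nonneg_right ?_ (Real.exp_pos _).le
  rw [Real.exp_neg, inv_mul_le_iff₀ (Real.exp_pos _), Finset.mul_sum]
  refine (norm_sum_le _ _).trans (Finset.sum_le_sum fun j _ => ?_)
  rw [norm_smul, ← mul_assoc]
  refine mul_le_mul_of_nonneg_right ?_ (norm_nonneg _)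
  rw [Real.norm_of_nonneg (by positivity)]
  have := Real.pow_div_factorial_le_exp (-z.re / 2 * t) (by positivity) j
  rw [mul_pow, div_eq_mul_inv] at this
  rw [inv_pow, ← div_eq_mul_inv, le_div_iff₀ (by positivity)]
  linarith

theorem ExpDecay.add {M : Matrix (Fin n) (Fin n) ℂ} {v w : Fin n → ℂ} (hv : ExpDecay M v)
    (hw : ExpDecay M w) : ExpDecay M (v + w) := by
  obtain ⟨c, hc, C, hC⟩ := hv
  obtain ⟨d, hd, D, hD⟩ := hw
  refine ⟨min c d, lt_min hc hd, |C| + |D|, fun t ht => ?_⟩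
  rw [flow_add_vec, add_mul]
  refine (norm_add_le _ _).trans (add_le_add ((hC t ht).trans ?_) ((hD t ht).trans ?_))
  · refine mul_le_mul (le_abs_self _) (Real.exp_le_exp.2 ?_) (Real.exp_pos _).le (abs_nonneg _)
    nlinarith [min_le_left c d]
  · refine mul_le_mul (le_abs_self _) (Real.exp_le_exp.2 ?_) (Real.exp_pos _).le (abs_nonneg _)
    nlinarith [min_le_right c d]

theorem expDecay_of_mem_stableSubspace {M : Matrix (Fin n) (Fin n) ℂ} {v : Fin n → ℂ}
    (hv : v ∈ stableSubspace M) : ExpDecay M v := by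
  refine Submodule.iSup_induction _ (motive := ExpDecay M) hv (fun z w hw => ?_) ?_
    fun _ _ => ExpDecay.add
  · obtain ⟨k, hk⟩ := mem_maxGenEigenspace_toLin'.1 hw
    exact expDecay_of_pow_mulVec_eq_zero z.2 hk
  · exact ⟨1, one_pos, 0, fun t _ => by simp [flow]⟩

theorem ExpDecay.tendsto {M : Matrix (Fin n) (Fin n) ℂ} {v : Fin n → ℂ} (hv : ExpDecay M v) :
    Tendsto (fun t => flow M t v) atTop (𝓝 0) := by
  obtain ⟨c, hc, C, hC⟩ := hv
  refine squeeze_zero_norm' (eventually_atTop.2 ⟨0, hC⟩) ?_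
  have : Tendsto (fun t : ℝ => Real.exp (-c * t)) atTop (𝓝 0) :=
    Real.tendsto_exp_atBot.comp (tendsto_id.const_mul_atTop_of_neg (neg_lt_zero.2 hc))
  simpa using this.const_mul C

theorem mem_spectrum_of_mulVec_eq_smul {M : Matrix (Fin n) (Fin n) ℂ} {z : ℂ} {v : Fin n → ℂ}
    (hv : v ≠ 0) (h : M *ᵥ v = z • v) : z ∈ spectrum ℂ M := by
  rw [← Matrix.spectrum_toLin', ← Module.End.hasEigenvalue_iff_mem_spectrum]
  exact Module.End.hasEigenvalue_of_hasEigenvector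
    ⟨Module.End.mem_eigenspace_iff.2 (by simpa using h), hv⟩

theorem mem_spectrum_of_mem_maxGenEigenspace {M : Matrix (Fin n) (Fin n) ℂ} {z : ℂ}
    {v : Fin n → ℂ} (hv : v ≠ 0) (h : v ∈ Module.End.maxGenEigenspace (Matrix.toLin' M) z) :
    z ∈ spectrum ℂ M := by
  rw [← Matrix.spectrum_toLin', ← Module.End.hasEigenvalue_iff_mem_spectrum]
  have : Module.End.HasUnifEigenvalue (Matrix.toLin' M) z ⊤ :=
    fun h0 => hv (by simpa [Module.End.maxGenEigenspace, h0] using h)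
  exact this.lt one_pos

theorem iSup_maxGenEigenspace_toLin' (M : Matrix (Fin n) (Fin n) ℂ) :
    ⨆ z, Module.End.maxGenEigenspace (Matrix.toLin' M) z = ⊤ :=
  Module.End.iSup_maxGenEigenspace_eq_top _

theorem stableSubspace_eq_top {M : Matrix (Fin n) (Fin n) ℂ} (hM : IsHurwitz M) :
    stableSubspace M = ⊤ := by
  rw [eq_top_iff, ← iSup_maxGenEigenspace_toLin' M]
  refine iSup_le fun z v hv => ?_
  by_cases h0 : v = 0
  · simp [h0]
  · exact Submodule.mem_iSup_of_mem
      (p := fun z : {z : ℂ // z.re < 0} => Module.End.maxGenEigenspace (Matrix.toLin' M) z.1)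
      ⟨z, hM z (mem_spectrum_of_mem_maxGenEigenspace h0 hv)⟩ hv

/-- The span of the generalized eigenvectors for eigenvalues with nonnegative real part. -/
def antistableSubspace (M : Matrix (Fin n) (Fin n) ℂ) : Submodule ℂ (Fin n → ℂ) :=
  ⨆ z : {z : ℂ // 0 ≤ z.re}, Module.End.maxGenEigenspace (Matrix.toLin' M) z.1

theorem exists_stable_add_antistable (M : Matrix (Fin n) (Fin n) ℂ) (v : Fin n → ℂ) :
    ∃ s ∈ stableSubspace M, ∃ r ∈ antistableSubspace M, s + r = v := by
  rw [← Submodule.mem_sup]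
  have : v ∈ ⨆ z, Module.End.maxGenEigenspace (Matrix.toLin' M) z := by
    rw [iSup_maxGenEigenspace_toLin']; trivial
  refine (iSup_le fun z => ?_ : (⨆ z, Module.End.maxGenEigenspace (Matrix.toLin' M) z) ≤ _) this
  by_cases hz : z.re < 0
  · exact (le_iSup (fun z : {z : ℂ // z.re < 0} =>
      Module.End.maxGenEigenspace (Matrix.toLin' M) z.1) ⟨z, hz⟩).trans le_sup_left
  · exact (le_iSup (fun z : {z : ℂ // 0 ≤ z.re} =>
      Module.End.maxGenEigenspace (Matrix.toLin' M) z.1) ⟨z, not_lt.1 hz⟩).trans le_sup_right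

/-- The vectors whose orbit tends to `0`. -/
def decaySubmodule (M : Matrix (Fin n) (Fin n) ℂ) : Submodule ℂ (Fin n → ℂ) where
  carrier := {v | Tendsto (fun t => flow M t v) atTop (𝓝 0)}
  zero_mem' := by simp [flow]
  add_mem' {v w} hv hw := by
    simpa [flow_add_vec] using Tendsto.add (mem_ofPred.1 hv) (mem_ofPred.1 hw)
  smul_mem' c v hv := by simpa [flow_smul_vec] using Tendsto.const_smul (mem_ofPred.1 hv) c

theorem mem_decaySubmodule {M : Matrix (Fin n) (Fin n) ℂ} {v : Fin n → ℂ} :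
    v ∈ decaySubmodule M ↔ Tendsto (fun t => flow M t v) atTop (𝓝 0) := Iff.rfl

theorem mulVec_mem_decaySubmodule {M : Matrix (Fin n) (Fin n) ℂ} {v : Fin n → ℂ}
    (hv : v ∈ decaySubmodule M) : M *ᵥ v ∈ decaySubmodule M := by
  rw [mem_decaySubmodule] at *
  simp_rw [← mulVec_flow]
  have : Continuous fun w : Fin n → ℂ => M *ᵥ w :=
    Continuous.matrix_mulVec continuous_const continuous_id
  simpa [Function.comp_def] using (this.tendsto 0).comp hv

/-- Since the decaying vectors form an invariant subspace, induction on the order reduces to a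
genuine eigenvector, whose orbit has norm e^{t Re z}‖v‖ ≥ ‖v‖. -/
theorem eq_zero_of_mem_decaySubmodule {M : Matrix (Fin n) (Fin n) ℂ} {z : ℂ} (hz : 0 ≤ z.re)
    {v : Fin n → ℂ} (hv : v ∈ decaySubmodule M)
    (hg : v ∈ Module.End.maxGenEigenspace (Matrix.toLin' M) z) : v = 0 := by
  obtain ⟨k, hk⟩ := mem_maxGenEigenspace_toLin'.1 hg
  clear hg
  induction k generalizing v with
  | zero => simpa using hk
  | succ k ih =>
    have h1 : (M - z • 1) *ᵥ v = 0 := by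
      refine ih ?_ ?_
      · rw [Matrix.sub_mulVec]
        refine Submodule.sub_mem _ (mulVec_mem_decaySubmodule hv) ?_
        simpa [Matrix.smul_mulVec] using Submodule.smul_mem _ z hv
      · rwa [Matrix.mulVec_mulVec, ← pow_succ]
    rw [mem_decaySubmodule] at hv
    have h2 : ∀ t, 0 ≤ t → ‖v‖ ≤ ‖flow M t v‖ := by
      intro t ht
      rw [flow_eq_sum (k := 1) (by simpa using h1), norm_smul, Complex.norm_exp]
      simp only [Finset.range_one, Finset.sum_singleton, Nat.factorial_zero, Nat.cast_one, inv_one,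
        pow_zero, mul_one, one_smul, Matrix.one_mulVec, Complex.re_ofReal_mul]
      exact le_mul_of_one_le_left (norm_nonneg _) (Real.one_le_exp (mul_nonneg ht hz))
    have h3 := ge_of_tendsto hv.norm (eventually_atTop.2 ⟨0, h2⟩)
    simpa using h3

/-- The orbit of `v` tends to `0` exactly when `v` lies in the stable subspace; this is the
nontrivial half. -/
theorem mem_stableSubspace_of_tendsto {M : Matrix (Fin n) (Fin n) ℂ} {v : Fin n → ℂ}
    (hv : Tendsto (fun t => flow M t v) atTop (𝓝 0)) : v ∈ stableSubspace M := by
  -- An invariant subspace is the sum of its intersections with the generalized eigenspaces, so each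
  -- eigenvalue can be treated separately.
  have h := Submodule.eq_iSup_inf_genEigenspace (p := decaySubmodule M) (f := Matrix.toLin' M) ⊤
    (fun w hw => by simpa using mulVec_mem_decaySubmodule hw) (iSup_maxGenEigenspace_toLin' M)
  have hv' : v ∈ decaySubmodule M := hv
  rw [h] at hv'
  refine (iSup_le fun z w hw => ?_ : _ ≤ stableSubspace M) hv'
  by_cases hz : z.re < 0
  · exact Submodule.mem_iSup_of_mem
      (p := fun z : {z : ℂ // z.re < 0} => Module.End.maxGenEigenspace (Matrix.toLin' M) z.1)
      ⟨z, hz⟩ hw.2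
  · rw [eq_zero_of_mem_decaySubmodule (not_lt.1 hz) hw.1 hw.2]
    exact Submodule.zero_mem _

theorem pow_sub_mulVec_of_intertwine {T : Matrix (Fin k) (Fin n) ℂ} {M : Matrix (Fin n) (Fin n) ℂ}
    {N : Matrix (Fin k) (Fin k) ℂ} (h : T * M = N * T) (z : ℂ) (j : ℕ) (v : Fin n → ℂ) :
    (N - z • 1) ^ j *ᵥ (T *ᵥ v) = T *ᵥ ((M - z • 1) ^ j *ᵥ v) := by
  induction j with
  | zero => simp
  | succ j ih =>
    rw [pow_succ', ← Matrix.mulVec_mulVec, ih, pow_succ', ← Matrix.mulVec_mulVec,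
      Matrix.mulVec_mulVec, Matrix.mulVec_mulVec _ T]
    congr 1
    rw [Matrix.sub_mul, Matrix.mul_sub, h]
    simp

/-- Applied to the inclusion of the J_s coordinates (from J_s to A) and to W_u⁻¹ times the unstable
projection (from the closed loop to −J_u†). -/
theorem mulVec_mem_maxGenEigenspace {T : Matrix (Fin k) (Fin n) ℂ} {M : Matrix (Fin n) (Fin n) ℂ}
    {N : Matrix (Fin k) (Fin k) ℂ} (h : T * M = N * T) {z : ℂ} {v : Fin n → ℂ}
    (hv : v ∈ Module.End.maxGenEigenspace (Matrix.toLin' M) z) :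
    T *ᵥ v ∈ Module.End.maxGenEigenspace (Matrix.toLin' N) z := by
  rw [mem_maxGenEigenspace_toLin'] at *
  obtain ⟨j, hj⟩ := hv
  exact ⟨j, by rw [pow_sub_mulVec_of_intertwine h, hj, Matrix.mulVec_zero]⟩

end

/-! ### Superposition of trajectories and of admissible controls -/

section

variable {n m : ℕ} {A : Matrix (Fin n) (Fin n) ℂ} {B : Matrix (Fin n) (Fin m) ℂ}

/-- `B u` as a continuous linear function of `u`. -/
def inputCLM (B : Matrix (Fin n) (Fin m) ℂ) : EuclideanSpace ℂ (Fin m) →L[ℂ] (Fin n → ℂ) :=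
  (LinearMap.toContinuousLinearMap (Matrix.toLin' B)).comp
    (PiLp.continuousLinearEquiv 2 ℂ fun _ : Fin m => ℂ).toContinuousLinearMap

theorem memLp_Icc_of_memLp {E : Type*} [NormedAddCommGroup E] {u : ℝ → E}
    (hu : MemLp u 2 (volume.restrict (Ici 0))) (T : ℝ) :
    MemLp u 2 (volume.restrict (Icc 0 T)) :=
  hu.mono_measure (Measure.restrict_mono Icc_subset_Ici_self le_rfl)

theorem intervalIntegrable_of_memLp {E : Type*} [NormedAddCommGroup E] {u : ℝ → E}
    (hu : MemLp u 2 (volume.restrict (Ici 0))) {T : ℝ} (hT : 0 ≤ T) :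
    IntervalIntegrable u volume 0 T := by
  rw [intervalIntegrable_iff_integrableOn_Icc_of_le hT]
  exact (memLp_Icc_of_memLp hu T).integrable one_le_two

theorem intervalIntegrable_mulVec (A : Matrix (Fin n) (Fin n) ℂ) {x : ℝ → Fin n → ℂ}
    (hx : ContinuousOn x (Ici 0)) {T : ℝ} (hT : 0 ≤ T) :
    IntervalIntegrable (fun s => A *ᵥ x s) volume 0 T := by
  refine ContinuousOn.intervalIntegrable ?_
  rw [uIcc_of_le hT]
  have : Continuous fun w : Fin n → ℂ => A *ᵥ w :=
    Continuous.matrix_mulVec continuous_const continuous_id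
  exact this.comp_continuousOn (hx.mono Icc_subset_Ici_self)

theorem intervalIntegrable_input (B : Matrix (Fin n) (Fin m) ℂ)
    {u : ℝ → EuclideanSpace ℂ (Fin m)} (hu : MemLp u 2 (volume.restrict (Ici 0))) {T : ℝ}
    (hT : 0 ≤ T) : IntervalIntegrable (fun s => B *ᵥ (u s).ofLp) volume 0 T := by
  have := intervalIntegrable_of_memLp hu hT
  rw [intervalIntegrable_iff] at *
  exact (inputCLM B).integrable_comp this

theorem intervalIntegrable_rhs {x : ℝ → Fin n → ℂ} {u : ℝ → EuclideanSpace ℂ (Fin m)}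
    (hx : ContinuousOn x (Ici 0)) (hu : MemLp u 2 (volume.restrict (Ici 0))) {T : ℝ}
    (hT : 0 ≤ T) : IntervalIntegrable (fun s => A *ᵥ x s + B *ᵥ (u s).ofLp) volume 0 T :=
  (intervalIntegrable_mulVec A hx hT).add (intervalIntegrable_input B hu hT)

theorem IsTrajectory.add {x₀ y₀ : Fin n → ℂ} {u v : ℝ → EuclideanSpace ℂ (Fin m)}
    {x y : ℝ → Fin n → ℂ} (hx : IsTrajectory A B x₀ u x) (hy : IsTrajectory A B y₀ v y)
    (hu : MemLp u 2 (volume.restrict (Ici 0))) (hv : MemLp v 2 (volume.restrict (Ici 0))) :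
    IsTrajectory A B (x₀ + y₀) (u + v) (x + y) := by
  refine ⟨hx.1.add hy.1, fun t ht => ?_⟩
  have h : ∀ s, A *ᵥ (x + y) s + B *ᵥ ((u + v) s).ofLp =
      (A *ᵥ x s + B *ᵥ (u s).ofLp) + (A *ᵥ y s + B *ᵥ (v s).ofLp) := by
    intro s
    simp only [Pi.add_apply, WithLp.ofLp_add, Matrix.mulVec_add]
    abel
  simp only [h]
  rw [intervalIntegral.integral_add (intervalIntegrable_rhs hx.1 hu ht)
    (intervalIntegrable_rhs hy.1 hv ht), Pi.add_apply, hx.2 t ht, hy.2 t ht]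
  abel

theorem IsTrajectory.smul {x₀ : Fin n → ℂ} {u : ℝ → EuclideanSpace ℂ (Fin m)}
    {x : ℝ → Fin n → ℂ} (hx : IsTrajectory A B x₀ u x) (c : ℂ) :
    IsTrajectory A B (c • x₀) (c • u) (c • x) := by
  refine ⟨hx.1.const_smul c, fun t ht => ?_⟩
  have h : ∀ s, A *ᵥ (c • x) s + B *ᵥ ((c • u) s).ofLp =
      c • (A *ᵥ x s + B *ᵥ (u s).ofLp) := by
    intro s
    simp only [Pi.smul_apply, WithLp.ofLp_smul, Matrix.mulVec_smul, smul_add]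
  simp only [h]
  rw [intervalIntegral.integral_smul, Pi.smul_apply, hx.2 t ht, smul_add]

theorem add_mem_admissible {x₀ y₀ : Fin n → ℂ} {u v : ℝ → EuclideanSpace ℂ (Fin m)}
    (hu : u ∈ admissible A B x₀) (hv : v ∈ admissible A B y₀) :
    u + v ∈ admissible A B (x₀ + y₀) := by
  obtain ⟨hu, x, hx, hx0⟩ := hu
  obtain ⟨hv, y, hy, hy0⟩ := hv
  exact ⟨hu.add hv, x + y, hx.add hy hu hv, by simpa using! hx0.add hy0⟩

theorem smul_mem_admissible {x₀ : Fin n → ℂ} {u : ℝ → EuclideanSpace ℂ (Fin m)}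
    (hu : u ∈ admissible A B x₀) (c : ℂ) : c • u ∈ admissible A B (c • x₀) := by
  obtain ⟨hu, x, hx, hx0⟩ := hu
  exact ⟨hu.const_smul c, c • x, hx.smul c, by simpa using! hx0.const_smul c⟩

/-! ### Delayed controls -/

/-- The control that waits until time `T` and then applies `b`. -/
def delay (T : ℝ) (b : ℝ → EuclideanSpace ℂ (Fin m)) : ℝ → EuclideanSpace ℂ (Fin m) :=
  (Ici T).indicator fun t => b (t - T)

theorem measurePreserving_sub_Ici (T : ℝ) :
    MeasurePreserving (fun t : ℝ => t - T) (volume.restrict (Ici T)) (volume.restrict (Ici 0)) := by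
  have h := (measurePreserving_sub_right (volume : Measure ℝ) T).restrict_preimage
    (measurableSet_Ici (a := (0 : ℝ)))
  have e : (fun t : ℝ => t - T) ⁻¹' Ici 0 = Ici T := by
    ext t; simp
  rwa [e] at h

theorem restrict_Ici_restrict_Ici {T : ℝ} (hT : 0 ≤ T) :
    (volume.restrict (Ici (0 : ℝ))).restrict (Ici T) = volume.restrict (Ici T) := by
  rw [Measure.restrict_restrict measurableSet_Ici, inter_eq_left.2 (Ici_subset_Ici.2 hT)]

theorem memLp_delay {T : ℝ} (hT : 0 ≤ T) {b : ℝ → EuclideanSpace ℂ (Fin m)}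
    (hb : MemLp b 2 (volume.restrict (Ici 0))) :
    MemLp (delay T b) 2 (volume.restrict (Ici 0)) := by
  rw [delay, memLp_indicator_iff_restrict measurableSet_Ici, restrict_Ici_restrict_Ici hT]
  exact hb.comp_measurePreserving (measurePreserving_sub_Ici T)

theorem energy_delay {T : ℝ} (hT : 0 ≤ T) (b : ℝ → EuclideanSpace ℂ (Fin m)) :
    energy (delay T b) = energy b := by
  have h : ∀ t, ‖delay T b t‖ ^ 2 = (Ici T).indicator (fun t => ‖b (t - T)‖ ^ 2) t := by
    intro t
    by_cases ht : t ∈ Ici T <;> simp [delay, ht]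
  simp only [energy, h]
  rw [setIntegral_indicator measurableSet_Ici, inter_eq_right.2 (Ici_subset_Ici.2 hT)]
  exact (measurePreserving_sub_Ici T).integral_comp (Homeomorph.subRight T).measurableEmbedding
    fun t => ‖b t‖ ^ 2

/-- The min/max formula glues free motion up to T to the shifted trajectory without a case split: on
each side of T one summand is frozen and cancels, and continuity is immediate. -/
theorem isTrajectory_delay {T : ℝ} (hT : 0 ≤ T) {y₀ : Fin n → ℂ}
    {b : ℝ → EuclideanSpace ℂ (Fin m)} {x : ℝ → Fin n → ℂ}
    (hb : MemLp b 2 (volume.restrict (Ici 0)))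
    (hx : IsTrajectory A B (flow A T y₀) b x) :
    IsTrajectory A B y₀ (delay T b)
      (fun t => flow A (min t T) y₀ + (x (max (t - T) 0) - flow A T y₀)) := by
  have hx0 : x 0 = flow A T y₀ := by simpa using hx.2 0 le_rfl
  have hle : ∀ t ≤ T, flow A (min t T) y₀ + (x (max (t - T) 0) - flow A T y₀) = flow A t y₀ := by
    intro t ht
    rw [min_eq_left ht, max_eq_right (by linarith), hx0]
    abel
  have hge : ∀ t, T ≤ t → flow A (min t T) y₀ + (x (max (t - T) 0) - flow A T y₀) = x (t - T) := by
    intro t ht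
    rw [min_eq_right ht, max_eq_left (by linarith)]
    abel
  have hcont : Continuous fun t => flow A (min t T) y₀ + (x (max (t - T) 0) - flow A T y₀) := by
    refine ((continuous_flow A y₀).comp (by fun_prop)).add (Continuous.sub ?_ continuous_const)
    exact hx.1.comp_continuous (by fun_prop) fun s => mem_Ici.2 (le_max_right _ _)
  have hd := memLp_delay hT hb
  have hint := fun {t : ℝ} (ht : 0 ≤ t) =>
    intervalIntegrable_rhs (A := A) (B := B) hcont.continuousOn hd ht
  have h1 : ∀ t, 0 ≤ t → t ≤ T → flow A t y₀ = y₀ + ∫ s in (0 : ℝ)..t,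
      (A *ᵥ (flow A (min s T) y₀ + (x (max (s - T) 0) - flow A T y₀)) +
        B *ᵥ (delay T b s).ofLp) := by
    intro t ht htT
    conv_lhs => rw [flow_eq_integral]
    congr 1
    refine intervalIntegral.integral_congr_ae ?_
    -- At s = T itself the delayed control already takes the value b 0, so this one point is
    -- discarded.
    have : ∀ᵐ s : ℝ, s ≠ T := by simp [ae_iff]
    filter_upwards [this] with s hs hst
    rw [uIoc_of_le ht] at hst
    have hlt : s < T := lt_of_le_of_ne (hst.2.trans htT) hs
    rw [hle s hlt.le]
    have : delay T b s = 0 := by simp [delay, hlt]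
    simp [this]
  refine ⟨hcont.continuousOn, fun t ht => ?_⟩
  rcases le_total t T with h | h
  · simp only [hle t h]
    exact h1 t ht h
  · simp only [hge t h]
    rw [hx.2 (t - T) (by linarith)]
    conv_lhs => rw [h1 T hT le_rfl]
    rw [← intervalIntegral.integral_add_adjacent_intervals (hint hT)
      ((hint hT).symm.trans (hint ht)), add_assoc]
    congr 2
    have := intervalIntegral.integral_comp_sub_right
      (fun s => A *ᵥ x s + B *ᵥ (b s).ofLp) (a := T) (b := t) T
    rw [sub_self] at this
    rw [← this]
    refine intervalIntegral.integral_congr fun s hs => ?_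
    rw [uIcc_of_le h] at hs
    simp only [hge s hs.1]
    simp [delay, hs.1]

theorem delay_mem_admissible {T : ℝ} (hT : 0 ≤ T) {y₀ : Fin n → ℂ}
    {b : ℝ → EuclideanSpace ℂ (Fin m)} (hb : b ∈ admissible A B (flow A T y₀)) :
    delay T b ∈ admissible A B y₀ := by
  obtain ⟨hb, x, hx, hx0⟩ := hb
  refine ⟨memLp_delay hT hb, _, isTrajectory_delay hT hb hx, ?_⟩
  have : Tendsto (fun t => x (t - T)) atTop (𝓝 0) :=
    hx0.comp (tendsto_atTop_add_const_right _ _ tendsto_id)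
  refine this.congr' ((eventually_ge_atTop T).mono fun t ht => ?_)
  simp only [min_eq_right ht, max_eq_left (sub_nonneg.2 ht)]
  abel

/-! ### Energy estimates and the infimal cost -/

theorem energy_nonneg (u : ℝ → EuclideanSpace ℂ (Fin m)) : 0 ≤ energy u :=
  integral_nonneg fun _ => sq_nonneg _

theorem integrable_sq {E : Type*} [NormedAddCommGroup E] {μ : Measure ℝ} {u : ℝ → E}
    (hu : MemLp u 2 μ) : Integrable (fun t => ‖u t‖ ^ 2) μ :=
  (memLp_two_iff_integrable_sq_norm hu.1).1 hu

theorem energy_smul (c : ℂ) (u : ℝ → EuclideanSpace ℂ (Fin m)) :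
    energy (c • u) = ‖c‖ ^ 2 * energy u := by
  simp only [energy, Pi.smul_apply, norm_smul, mul_pow, integral_const_mul]

/-- The asymmetric weights matter: the factor of b tends to 1 as δ → 0, while the large factor is
placed on a term that vanishes. -/
theorem norm_add_sq_le_weighted {E : Type*} [NormedAddCommGroup E] (a b : E) {δ : ℝ}
    (hδ : 0 < δ) : ‖a + b‖ ^ 2 ≤ (1 + δ⁻¹) * ‖a‖ ^ 2 + (1 + δ) * ‖b‖ ^ 2 := by
  have h1 : ‖a + b‖ ^ 2 ≤ (‖a‖ + ‖b‖) ^ 2 :=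
    pow_le_pow_left₀ (norm_nonneg _) (norm_add_le a b) 2
  have h2 : 0 ≤ δ⁻¹ * (‖a‖ - δ * ‖b‖) ^ 2 := by positivity
  have h3 : δ⁻¹ * (‖a‖ - δ * ‖b‖) ^ 2 = δ⁻¹ * ‖a‖ ^ 2 - 2 * ‖a‖ * ‖b‖ + δ * ‖b‖ ^ 2 := by
    field_simp; ring
  nlinarith

theorem energy_add_le {u v : ℝ → EuclideanSpace ℂ (Fin m)}
    (hu : MemLp u 2 (volume.restrict (Ici 0))) (hv : MemLp v 2 (volume.restrict (Ici 0)))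
    {δ : ℝ} (hδ : 0 < δ) : energy (u + v) ≤ (1 + δ⁻¹) * energy u + (1 + δ) * energy v := by
  simp only [energy]
  rw [← integral_const_mul, ← integral_const_mul, ← integral_add ((integrable_sq hu).const_mul _)
    ((integrable_sq hv).const_mul _)]
  exact integral_mono (integrable_sq (hu.add hv))
    (((integrable_sq hu).const_mul _).add ((integrable_sq hv).const_mul _))
    fun t => norm_add_sq_le_weighted _ _ hδ

/-- The two controls overlap only after T, so the large weight multiplies only the tail of u. -/
theorem energy_add_delay_le {u v : ℝ → EuclideanSpace ℂ (Fin m)}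
    (hu : MemLp u 2 (volume.restrict (Ici 0))) (hv : MemLp v 2 (volume.restrict (Ici 0)))
    {T : ℝ} (hT : 0 ≤ T) {δ : ℝ} (hδ : 0 < δ) :
    energy (u + delay T v) ≤
      energy u + (1 + δ⁻¹) * (∫ t in Ici T, ‖u t‖ ^ 2) + (1 + δ) * energy v := by
  have hd := memLp_delay hT hv
  have i1 := integrable_sq hu
  have i2 : Integrable ((Ici T).indicator fun t => ‖u t‖ ^ 2) (volume.restrict (Ici 0)) :=
    i1.indicator measurableSet_Ici
  have i3 := integrable_sq hd
  have h2 : ∫ t in Ici T, ‖u t‖ ^ 2 =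
      ∫ t in Ici (0 : ℝ), (Ici T).indicator (fun t => ‖u t‖ ^ 2) t := by
    rw [setIntegral_indicator measurableSet_Ici, inter_eq_right.2 (Ici_subset_Ici.2 hT)]
  rw [← energy_delay hT v, h2]
  simp only [energy]
  have i12 : Integrable (fun t => ‖u t‖ ^ 2 + (1 + δ⁻¹) * (Ici T).indicator (fun t => ‖u t‖ ^ 2) t)
      (volume.restrict (Ici 0)) := i1.add (i2.const_mul _)
  rw [← integral_const_mul, ← integral_const_mul, ← integral_add i1 (i2.const_mul _),
    ← integral_add i12 (i3.const_mul _)]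
  refine integral_mono (integrable_sq (hu.add hd))
    (i12.add (i3.const_mul _)) fun t => ?_
  by_cases ht : t ∈ Ici T
  · simp only [Pi.add_apply, indicator_of_mem ht]
    have := norm_add_sq_le_weighted (u t) (delay T v t) hδ
    nlinarith [sq_nonneg ‖u t‖]
  · have : delay T v t = 0 := by simp [delay, ht]
    simp [indicator_of_notMem ht, this]

theorem tendsto_tail_zero {u : ℝ → EuclideanSpace ℂ (Fin m)}
    (hu : MemLp u 2 (volume.restrict (Ici 0))) :
    Tendsto (fun T : ℝ => ∫ t in Ici T, ‖u t‖ ^ 2) atTop (𝓝 0) := by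
  have h := tendsto_setIntegral_of_antitone (μ := volume) (f := fun t => ‖u t‖ ^ 2)
    (s := fun T : ℝ => Ici T) (fun _ => measurableSet_Ici)
    (fun _ _ h => Ici_subset_Ici.2 h) ⟨0, integrable_sq hu⟩
  have e : ⋂ T : ℝ, Ici T = ∅ := by
    ext t
    simpa using ⟨t + 1, by linarith⟩
  simpa [e] using h

/-- The infimal energy needed to steer `x₀` to `0` in infinite time. -/
def optimalCost (A : Matrix (Fin n) (Fin n) ℂ) (B : Matrix (Fin n) (Fin m) ℂ)
    (x₀ : Fin n → ℂ) : ℝ :=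
  sInf (energy '' admissible A B x₀)

theorem optimalCost_le {x₀ : Fin n → ℂ} {u : ℝ → EuclideanSpace ℂ (Fin m)}
    (hu : u ∈ admissible A B x₀) : optimalCost A B x₀ ≤ energy u :=
  csInf_le ⟨0, by rintro _ ⟨u, -, rfl⟩; exact energy_nonneg u⟩ ⟨u, hu, rfl⟩

theorem optimalCost_nonneg (x₀ : Fin n → ℂ) : 0 ≤ optimalCost A B x₀ :=
  Real.sInf_nonneg (by rintro _ ⟨u, -, rfl⟩; exact energy_nonneg u)

/-- Nonemptiness is essential here, because the infimum of the empty set is 0 by convention. -/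
theorem exists_energy_lt (hne : ∀ x₀, (admissible A B x₀).Nonempty) {x₀ : Fin n → ℂ} {c : ℝ}
    (h : optimalCost A B x₀ < c) : ∃ u ∈ admissible A B x₀, energy u < c := by
  obtain ⟨_, ⟨u, hu, rfl⟩, h⟩ := exists_lt_of_csInf_lt ((hne x₀).image energy) h
  exact ⟨u, hu, h⟩

theorem optimalCost_smul_le (hne : ∀ x₀, (admissible A B x₀).Nonempty) (c : ℂ)
    (x₀ : Fin n → ℂ) : optimalCost A B (c • x₀) ≤ ‖c‖ ^ 2 * optimalCost A B x₀ := by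
  refine le_of_forall_pos_le_add fun ε hε => ?_
  obtain ⟨u, hu, h⟩ := exists_energy_lt hne (x₀ := x₀)
    (c := optimalCost A B x₀ + ε / (‖c‖ ^ 2 + 1)) (lt_add_of_pos_right _ (by positivity))
  refine (optimalCost_le (smul_mem_admissible hu c)).trans ?_
  rw [energy_smul]
  have h1 : ‖c‖ ^ 2 * (ε / (‖c‖ ^ 2 + 1)) ≤ ε := by
    rw [mul_div_assoc', div_le_iff₀ (by positivity)]
    nlinarith [sq_nonneg ‖c‖]
  nlinarith [sq_nonneg ‖c‖]

theorem optimalCost_add_le (hne : ∀ x₀, (admissible A B x₀).Nonempty) (x₀ y₀ : Fin n → ℂ)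
    {δ : ℝ} (hδ : 0 < δ) : optimalCost A B (x₀ + y₀) ≤
      (1 + δ⁻¹) * optimalCost A B x₀ + (1 + δ) * optimalCost A B y₀ := by
  refine le_of_forall_pos_le_add fun ε hε => ?_
  have hδ' : 0 < δ⁻¹ := inv_pos.2 hδ
  have hpos : 0 < ε / ((1 + δ⁻¹) + (1 + δ)) := by positivity
  obtain ⟨u, hu, h⟩ := exists_energy_lt hne (lt_add_of_pos_right (optimalCost A B x₀) hpos)
  obtain ⟨v, hv, h'⟩ := exists_energy_lt hne (lt_add_of_pos_right (optimalCost A B y₀) hpos)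
  refine (optimalCost_le (add_mem_admissible hu hv)).trans ((energy_add_le hu.1 hv.1 hδ).trans ?_)
  have e : ((1 + δ⁻¹) + (1 + δ)) * (ε / ((1 + δ⁻¹) + (1 + δ))) = ε := by field_simp
  have h1 := mul_le_mul_of_nonneg_left h.le (by positivity : 0 ≤ 1 + δ⁻¹)
  have h2 := mul_le_mul_of_nonneg_left h'.le (by positivity : 0 ≤ 1 + δ)
  nlinarith

/-- The large weight 1 + δ⁻¹ multiplies a zero cost, so δ → 0 costs nothing. -/
theorem optimalCost_add_le_of_eq_zero (hne : ∀ x₀, (admissible A B x₀).Nonempty)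
    (x₀ : Fin n → ℂ) {y₀ : Fin n → ℂ} (hy : optimalCost A B y₀ = 0) :
    optimalCost A B (x₀ + y₀) ≤ optimalCost A B x₀ := by
  have h : ∀ δ > 0, optimalCost A B (x₀ + y₀) ≤ (1 + δ) * optimalCost A B x₀ := by
    intro δ hδ
    have := optimalCost_add_le hne y₀ x₀ hδ
    rw [add_comm x₀]
    simpa [hy] using this
  have ht : Tendsto (fun δ : ℝ => (1 + δ) * optimalCost A B x₀) (𝓝[>] 0)
      (𝓝 ((1 + 0) * optimalCost A B x₀)) :=
    (Continuous.tendsto (by fun_prop) 0).mono_left nhdsWithin_le_nhds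
  have := ge_of_tendsto ht (eventually_nhdsWithin_of_forall h)
  simpa using this

/-- Steering the second component after a long waiting time makes the energies additive. -/
theorem optimalCost_add_le_of_flow_le (hne : ∀ x₀, (admissible A B x₀).Nonempty)
    (x₀ y₀ : Fin n → ℂ) {c : ℝ} (hy : ∀ T, 0 ≤ T → optimalCost A B (flow A T y₀) ≤ c) :
    optimalCost A B (x₀ + y₀) ≤ optimalCost A B x₀ + c := by
  have h : ∀ δ > 0, optimalCost A B (x₀ + y₀) ≤
      optimalCost A B x₀ + δ + δ + (1 + δ) * (c + δ) := by
    intro δ hδ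
    obtain ⟨u, hu, h⟩ := exists_energy_lt hne (lt_add_of_pos_right (optimalCost A B x₀) hδ)
    -- The delay is chosen after δ and u, so the tail of u can be made small against the fixed
    -- weight 1 + δ⁻¹.
    have h1 : ∀ᶠ T : ℝ in atTop, (1 + δ⁻¹) * (∫ t in Ici T, ‖u t‖ ^ 2) < δ := by
      have := (tendsto_tail_zero hu.1).const_mul (1 + δ⁻¹)
      rw [mul_zero] at this
      exact this.eventually_lt_const hδ
    obtain ⟨T, hT1, hT⟩ := (h1.and (eventually_ge_atTop 0)).exists
    obtain ⟨v, hv, h'⟩ := exists_energy_lt hne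
      ((hy T hT).trans_lt (lt_add_of_pos_right c hδ))
    refine (optimalCost_le (add_mem_admissible hu (delay_mem_admissible hT hv))).trans
      ((energy_add_delay_le hu.1 hv.1 hT hδ).trans ?_)
    have := mul_le_mul_of_nonneg_left h'.le (by positivity : 0 ≤ 1 + δ)
    linarith
  have ht : Tendsto (fun δ : ℝ => optimalCost A B x₀ + δ + δ + (1 + δ) * (c + δ)) (𝓝[>] 0)
      (𝓝 (optimalCost A B x₀ + 0 + 0 + (1 + 0) * (c + 0))) :=
    (Continuous.tendsto (by fun_prop) 0).mono_left nhdsWithin_le_nhds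
  have := ge_of_tendsto ht (eventually_nhdsWithin_of_forall h)
  simpa using this

/-- Delaying one of two copies gives V(2y) ≤ 2V(y), whereas homogeneity gives V(y) ≤ V(2y)/4;
together V(y) ≤ V(y)/2. -/
theorem optimalCost_eq_zero_of_flow_le (hne : ∀ x₀, (admissible A B x₀).Nonempty)
    {y₀ : Fin n → ℂ} (hy : ∀ T, 0 ≤ T → optimalCost A B (flow A T y₀) ≤ optimalCost A B y₀) :
    optimalCost A B y₀ = 0 := by
  have h1 := optimalCost_add_le_of_flow_le hne y₀ y₀ hy
  have h2 := optimalCost_smul_le hne (1 / 2 : ℂ) (y₀ + y₀)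
  have h3 : (1 / 2 : ℂ) • (y₀ + y₀) = y₀ := by
    rw [← two_smul ℂ y₀, smul_smul]; norm_num
  rw [h3] at h2
  norm_num at h2
  linarith [optimalCost_nonneg (A := A) (B := B) y₀]

/-- Generalized eigenvectors for eigenvalues with nonpositive real part can be steered to `0` with
arbitrarily small energy. -/
theorem optimalCost_eq_zero_of_pow_mulVec (hne : ∀ x₀, (admissible A B x₀).Nonempty) {z : ℂ}
    (hz : z.re ≤ 0) (k : ℕ) (v : Fin n → ℂ) (hv : (A - z • 1) ^ k *ᵥ v = 0) :
    optimalCost A B v = 0 := by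
  induction k generalizing v with
  | zero =>
    have : v = 0 := by simpa using hv
    subst this
    have := optimalCost_smul_le hne 0 (0 : Fin n → ℂ)
    simp only [smul_zero, norm_zero, ne_eq, OfNat.ofNat_ne_zero, not_false_eq_true, zero_pow,
      zero_mul] at this
    exact le_antisymm this (optimalCost_nonneg _)
  | succ k ih =>
    refine optimalCost_eq_zero_of_flow_le hne fun T hT => ?_
    -- The term j = 0 is e^{Tz}v, with |e^{Tz}| ≤ 1; the remaining terms are killed by the k-th
    -- power and cost nothing by induction.
    rw [flow_eq_sum hv, Finset.sum_range_succ', smul_add, add_comm]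
    refine (optimalCost_add_le_of_eq_zero hne _ (ih _ ?_)).trans ?_
    · rw [← mem_genEigenspace_toLin']
      refine Submodule.smul_mem _ _ (Submodule.sum_mem _ fun j _ => ?_)
      rw [← Complex.coe_smul]
      refine Submodule.smul_mem _ _ ?_
      rw [mem_genEigenspace_toLin', Matrix.mulVec_mulVec, ← pow_add,
        show k + (j + 1) = j + (k + 1) by ring, pow_add, ← Matrix.mulVec_mulVec, hv,
        Matrix.mulVec_zero]
    · simp only [Nat.factorial_zero, Nat.cast_one, inv_one, pow_zero, mul_one, one_smul,
        Matrix.one_mulVec]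
      refine (optimalCost_smul_le hne _ _).trans
        (mul_le_of_le_one_left (optimalCost_nonneg _) ?_)
      rw [Complex.norm_exp, Complex.re_ofReal_mul]
      exact pow_le_one₀ (Real.exp_pos _).le
        (Real.exp_le_one_iff.2 (mul_nonpos_of_nonneg_of_nonpos hT hz))

theorem optimalCost_add_eq_zero (hne : ∀ x₀, (admissible A B x₀).Nonempty) {v w : Fin n → ℂ}
    (hv : optimalCost A B v = 0) (hw : optimalCost A B w = 0) : optimalCost A B (v + w) = 0 :=
  le_antisymm ((optimalCost_add_le_of_eq_zero hne v hw).trans hv.le) (optimalCost_nonneg _)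

theorem optimalCost_eq_zero_of_mem_iSup (hne : ∀ x₀, (admissible A B x₀).Nonempty)
    {v : Fin n → ℂ}
    (hv : v ∈ ⨆ z : {z : ℂ // z.re ≤ 0}, Module.End.maxGenEigenspace (Matrix.toLin' A) z.1) :
    optimalCost A B v = 0 := by
  refine Submodule.iSup_induction _ (motive := fun v => optimalCost A B v = 0) hv
    (fun z w hw => ?_) ?_ fun _ _ => optimalCost_add_eq_zero hne
  · obtain ⟨k, hk⟩ := mem_maxGenEigenspace_toLin'.1 hw
    exact optimalCost_eq_zero_of_pow_mulVec hne z.2 k w hk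
  · exact optimalCost_eq_zero_of_pow_mulVec hne (z := 0) (by simp) 0 0 (by simp)

/-! ### State feedback controls -/

/-- The state feedback `u = F x`, along the closed-loop flow. -/
def feedback (A : Matrix (Fin n) (Fin n) ℂ) (B : Matrix (Fin n) (Fin m) ℂ)
    (F : Matrix (Fin m) (Fin n) ℂ) (x₀ : Fin n → ℂ) (t : ℝ) : EuclideanSpace ℂ (Fin m) :=
  WithLp.toLp 2 (F *ᵥ flow (A + B * F) t x₀)

theorem isTrajectory_feedback (F : Matrix (Fin m) (Fin n) ℂ) (x₀ : Fin n → ℂ) :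
    IsTrajectory A B x₀ (feedback A B F x₀) (fun t => flow (A + B * F) t x₀) := by
  refine ⟨(continuous_flow _ _).continuousOn, fun t _ => ?_⟩
  refine (flow_eq_integral _ _ _).trans ?_
  congr 2
  ext1 s
  simp [feedback, Matrix.add_mulVec, Matrix.mulVec_mulVec]

theorem continuous_feedback (F : Matrix (Fin m) (Fin n) ℂ) (x₀ : Fin n → ℂ) :
    Continuous (feedback A B F x₀) :=
  (PiLp.continuous_toLp 2 _).comp (Continuous.matrix_mulVec continuous_const (continuous_flow _ _))

theorem integrable_exp_neg_mul {c : ℝ} (hc : 0 < c) :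
    Integrable (fun t : ℝ => Real.exp (-c * t)) (volume.restrict (Ici 0)) := by
  change IntegrableOn _ _ _
  rw [integrableOn_Ici_iff_integrableOn_Ioi]
  exact exp_neg_integrableOn_Ioi 0 hc

theorem memLp_feedback {F : Matrix (Fin m) (Fin n) ℂ} {x₀ : Fin n → ℂ}
    (h : ExpDecay (A + B * F) x₀) :
    MemLp (feedback A B F x₀) 2 (volume.restrict (Ici 0)) := by
  obtain ⟨c, hc, C, hC⟩ := h
  let L : (Fin n → ℂ) →L[ℂ] EuclideanSpace ℂ (Fin m) :=
    ((PiLp.continuousLinearEquiv 2 ℂ fun _ : Fin m => ℂ).symm.toContinuousLinearMap).comp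
      (LinearMap.toContinuousLinearMap (Matrix.toLin' F))
  have hL : ∀ t, feedback A B F x₀ t = L (flow (A + B * F) t x₀) := fun t => rfl
  rw [memLp_two_iff_integrable_sq_norm
    (continuous_feedback F x₀).aestronglyMeasurable.restrict]
  have hg : Integrable (fun t : ℝ => (‖L‖ * C) ^ 2 * Real.exp (-(2 * c) * t))
      (volume.restrict (Ici 0)) :=
    (integrable_exp_neg_mul (by positivity)).const_mul _
  refine hg.mono' (((continuous_feedback F x₀).norm.pow 2).aestronglyMeasurable.restrict)
    ((ae_restrict_iff' measurableSet_Ici).2 (Eventually.of_forall fun t ht => ?_))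
  rw [Real.norm_of_nonneg (by positivity), hL]
  have h1 : ‖L (flow (A + B * F) t x₀)‖ ≤ ‖L‖ * C * Real.exp (-c * t) := by
    rw [mul_assoc]
    exact (L.le_opNorm _).trans (mul_le_mul_of_nonneg_left (hC t ht) (norm_nonneg _))
  have h2 : (‖L‖ * C) ^ 2 * Real.exp (-(2 * c) * t) = (‖L‖ * C * Real.exp (-c * t)) ^ 2 := by
    rw [mul_pow _ (Real.exp _), ← Real.exp_nat_mul]
    congr 2
    push_cast
    ring
  rw [h2]
  exact pow_le_pow_left₀ (norm_nonneg _) h1 2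

theorem feedback_mem_admissible {F : Matrix (Fin m) (Fin n) ℂ} {x₀ : Fin n → ℂ}
    (h : x₀ ∈ stableSubspace (A + B * F)) : feedback A B F x₀ ∈ admissible A B x₀ :=
  ⟨memLp_feedback (expDecay_of_mem_stableSubspace h), _, isTrajectory_feedback F x₀,
    (expDecay_of_mem_stableSubspace h).tendsto⟩

theorem Stabilizable.admissible_nonempty (hAB : Stabilizable A B) (x₀ : Fin n → ℂ) :
    (admissible A B x₀).Nonempty := by
  obtain ⟨F, hF⟩ := hAB
  exact ⟨_, feedback_mem_admissible (F := F) (by rw [stableSubspace_eq_top hF]; trivial)⟩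

end

/-! ### Riccati equation and completion of squares -/

section

variable {n m : ℕ} {A : Matrix (Fin n) (Fin n) ℂ} {B : Matrix (Fin n) (Fin m) ℂ}

/-- Increments of the primitive of f are dominated by those of the primitive of ‖f‖, which reduces
the claim to a real integrand. -/
theorem absolutelyContinuousOnInterval_integral {E : Type*} [NormedAddCommGroup E]
    [NormedSpace ℝ E] {f : ℝ → E} {a b : ℝ} (h : IntervalIntegrable f volume a b) :
    AbsolutelyContinuousOnInterval (fun x => ∫ v in a..x, f v) a b := by
  have hn : AbsolutelyContinuousOnInterval (fun x => ∫ v in a..x, ‖f v‖) a b :=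
    h.norm.absolutelyContinuousOnInterval_intervalIntegral left_mem_uIcc
  refine squeeze_zero' (Eventually.of_forall fun e => Finset.sum_nonneg fun _ _ => dist_nonneg)
    ?_ hn
  refine eventually_inf_principal.2 (Eventually.of_forall fun e he => ?_)
  refine Finset.sum_le_sum fun i hi => ?_
  obtain ⟨h1, h2⟩ := he.1 i hi
  have i1 := h.mono_set (uIcc_subset_uIcc left_mem_uIcc h1)
  have i2 := h.mono_set (uIcc_subset_uIcc left_mem_uIcc h2)
  rw [dist_eq_norm, dist_eq_norm, intervalIntegral.integral_interval_sub_left i1 i2,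
    intervalIntegral.integral_interval_sub_left i1.norm i2.norm, Real.norm_eq_abs]
  exact intervalIntegral.norm_integral_le_abs_integral_norm

/-- Integration by parts for primitives of integrable complex functions. -/
theorem integral_mul_add_mul_of_primitive {f g : ℝ → ℂ} {T : ℝ}
    (hf : IntervalIntegrable f volume 0 T) (hg : IntervalIntegrable g volume 0 T) (a b : ℂ) :
    ∫ t in (0 : ℝ)..T, (f t * (b + ∫ s in (0 : ℝ)..t, g s) + (a + ∫ s in (0 : ℝ)..t, f s) * g t) =
      (a + ∫ s in (0 : ℝ)..T, f s) * (b + ∫ s in (0 : ℝ)..T, g s) - a * b := by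
  have hF : AbsolutelyContinuousOnInterval (fun t => a + ∫ s in (0 : ℝ)..t, f s) 0 T :=
    (LipschitzOnWith.absolutelyContinuousOnInterval
      (LipschitzWith.const a).lipschitzOnWith).fun_add (absolutelyContinuousOnInterval_integral hf)
  have hG : AbsolutelyContinuousOnInterval (fun t => b + ∫ s in (0 : ℝ)..t, g s) 0 T :=
    (LipschitzOnWith.absolutelyContinuousOnInterval
      (LipschitzWith.const b).lipschitzOnWith).fun_add (absolutelyContinuousOnInterval_integral hg)
  have hint : IntervalIntegrable (fun t => f t * (b + ∫ s in (0 : ℝ)..t, g s) +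
      (a + ∫ s in (0 : ℝ)..t, f s) * g t) volume 0 T :=
    (hf.mul_continuousOn hG.continuousOn).add (hg.continuousOn_mul hF.continuousOn)
  -- The product of the primitives minus the primitive of the product-rule integrand is absolutely
  -- continuous with derivative zero almost everywhere, hence constant.
  have hH := (hF.fun_smul hG).sub (absolutelyContinuousOnInterval_integral hint)
  obtain ⟨C, hC⟩ := hH.const_of_ae_hasDerivAt_zero (by
    filter_upwards [hf.ae_hasDerivAt_integral, hg.ae_hasDerivAt_integral,
      hint.ae_hasDerivAt_integral] with t h1 h2 h3 ht
    have d1 := (h1 ht 0 left_mem_uIcc).const_add a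
    have d2 := (h2 ht 0 left_mem_uIcc).const_add b
    have := (d1.mul d2).sub (h3 ht 0 left_mem_uIcc)
    rw [sub_self] at this
    exact this)
  have h0 := hC 0 left_mem_uIcc
  have hT := hC T right_mem_uIcc
  simp only [Pi.sub_apply, intervalIntegral.integral_same, add_zero, sub_zero, smul_eq_mul] at h0 hT
  rw [h0, ← hT]
  ring

theorem integral_star {f : ℝ → ℂ} (a b : ℝ) :
    ∫ t in a..b, star (f t) = star (∫ t in a..b, f t) := by
  simp only [intervalIntegral, Complex.star_def, map_sub, integral_conj]

/-- The quadratic form `x† K x` along a primitive. -/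
theorem integral_quadratic_form (K : Matrix (Fin n) (Fin n) ℂ) {x g : ℝ → Fin n → ℂ}
    {x₀ : Fin n → ℂ} {T : ℝ} (hT : 0 ≤ T) (hg : IntervalIntegrable g volume 0 T)
    (hx : ∀ t, 0 ≤ t → x t = x₀ + ∫ s in (0 : ℝ)..t, g s) :
    ∫ t in (0 : ℝ)..T, (star (g t) ⬝ᵥ K *ᵥ x t + star (x t) ⬝ᵥ K *ᵥ g t) =
      star (x T) ⬝ᵥ K *ᵥ x T - star x₀ ⬝ᵥ K *ᵥ x₀ := by
  have hgi : ∀ (L : (Fin n → ℂ) →L[ℂ] ℂ) {t : ℝ}, 0 ≤ t → t ≤ T →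
      L (x t) = L x₀ + ∫ s in (0 : ℝ)..t, L (g s) := by
    intro L t ht htT
    have : IntervalIntegrable g volume 0 t := hg.mono_set (by
      rw [uIcc_of_le ht, uIcc_of_le hT]; exact Icc_subset_Icc_right htT)
    rw [hx t ht, map_add, L.intervalIntegral_comp_comm this]
  let P : Fin n → (Fin n → ℂ) →L[ℂ] ℂ := fun i => ContinuousLinearMap.proj i
  let Q : Fin n → (Fin n → ℂ) →L[ℂ] ℂ := fun i =>
    LinearMap.toContinuousLinearMap ((LinearMap.proj i).comp (Matrix.toLin' K))
  have hP : ∀ i v, P i v = v i := fun _ _ => rfl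
  have hQ : ∀ i v, Q i v = (K *ᵥ v) i := fun _ _ => rfl
  have hL : ∀ L : (Fin n → ℂ) →L[ℂ] ℂ, IntervalIntegrable (fun t => L (g t)) volume 0 T := by
    intro L
    rw [intervalIntegrable_iff] at *
    exact L.integrable_comp hg
  have hstar : ∀ i, IntervalIntegrable (fun t => star (P i (g t))) volume 0 T := by
    intro i
    have := hL (P i)
    rw [intervalIntegrable_iff] at *
    exact ((Complex.conjLIE.toContinuousLinearEquiv : ℂ →L[ℝ] ℂ)).integrable_comp this
  have key : ∀ i, ∫ t in (0 : ℝ)..T,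
      (star (P i (g t)) * Q i (x t) + star (P i (x t)) * Q i (g t)) =
      star (P i (x T)) * Q i (x T) - star (P i x₀) * Q i x₀ := by
    intro i
    have h := integral_mul_add_mul_of_primitive (hstar i) (hL (Q i)) (star (P i x₀)) (Q i x₀)
    simp only [integral_star, ← star_add] at h
    rw [hgi (P i) hT le_rfl, hgi (Q i) hT le_rfl, ← h]
    refine intervalIntegral.integral_congr fun t ht => ?_
    rw [uIcc_of_le hT] at ht
    simp only [hgi (P i) ht.1 ht.2, hgi (Q i) ht.1 ht.2]
  have hsum : ∀ t, star (g t) ⬝ᵥ K *ᵥ x t + star (x t) ⬝ᵥ K *ᵥ g t =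
      ∑ i, (star (P i (g t)) * Q i (x t) + star (P i (x t)) * Q i (g t)) := by
    intro t
    simp only [dotProduct, hP, hQ, Finset.sum_add_distrib, Pi.star_apply]
  have hxc : ContinuousOn x (uIcc 0 T) := by
    have : ContinuousOn (fun t => x₀ + ∫ s in (0 : ℝ)..t, g s) (uIcc 0 T) :=
      continuousOn_const.add (absolutelyContinuousOnInterval_integral hg).continuousOn
    refine this.congr fun t ht => hx t ?_
    rw [uIcc_of_le hT] at ht
    exact ht.1
  simp only [hsum]
  rw [intervalIntegral.integral_finsetSum, Finset.sum_congr rfl fun i _ => key i,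
    Finset.sum_sub_distrib]
  · simp [dotProduct, hP, hQ]
  · intro i _
    exact ((hstar i).mul_continuousOn ((Q i).continuous.comp_continuousOn hxc)).add
      ((hL (Q i)).continuousOn_mul
        (continuous_star.comp_continuousOn ((P i).continuous.comp_continuousOn hxc)))

theorem star_dotProduct_self (v : EuclideanSpace ℂ (Fin m)) :
    star v.ofLp ⬝ᵥ v.ofLp = ((‖v‖ ^ 2 : ℝ) : ℂ) := by
  rw [EuclideanSpace.norm_sq_eq]
  simp only [dotProduct, Pi.star_apply, Complex.star_def, Complex.ofReal_sum, Complex.conj_mul',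
    Complex.ofReal_pow]

/-- The deviation of the control from the feedback law. -/
def deviation (B : Matrix (Fin n) (Fin m) ℂ) (K : Matrix (Fin n) (Fin n) ℂ)
    (u : ℝ → EuclideanSpace ℂ (Fin m)) (x : ℝ → Fin n → ℂ) (t : ℝ) : EuclideanSpace ℂ (Fin m) :=
  u t + WithLp.toLp 2 ((Bᴴ * K) *ᵥ x t)

/-- The terms in Bu are the cross terms of the square, and the Riccati equation turns the terms in
Ax into ‖B†Kx‖². -/
theorem riccati_pointwise {K : Matrix (Fin n) (Fin n) ℂ} (hK : Kᴴ = K)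
    (hR : Aᴴ * K + K * A = K * B * Bᴴ * K) (u : EuclideanSpace ℂ (Fin m)) (x : Fin n → ℂ) :
    star (A *ᵥ x + B *ᵥ u.ofLp) ⬝ᵥ K *ᵥ x + star x ⬝ᵥ K *ᵥ (A *ᵥ x + B *ᵥ u.ofLp) =
      ((‖u + WithLp.toLp 2 ((Bᴴ * K) *ᵥ x)‖ ^ 2 : ℝ) : ℂ) - ((‖u‖ ^ 2 : ℝ) : ℂ) := by
  rw [← star_dotProduct_self, ← star_dotProduct_self]
  have h1 : star (A *ᵥ x) ⬝ᵥ K *ᵥ x = star x ⬝ᵥ (Aᴴ * K) *ᵥ x := by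
    rw [Matrix.star_mulVec, ← Matrix.dotProduct_mulVec, Matrix.mulVec_mulVec]
  have h2 : star (B *ᵥ u.ofLp) ⬝ᵥ K *ᵥ x = star u.ofLp ⬝ᵥ (Bᴴ * K) *ᵥ x := by
    rw [Matrix.star_mulVec, ← Matrix.dotProduct_mulVec, Matrix.mulVec_mulVec]
  have h3 : star x ⬝ᵥ K *ᵥ (B *ᵥ u.ofLp) = star ((Bᴴ * K) *ᵥ x) ⬝ᵥ u.ofLp := by
    rw [Matrix.star_mulVec, Matrix.conjTranspose_mul, Matrix.conjTranspose_conjTranspose, hK,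
      ← Matrix.dotProduct_mulVec, Matrix.mulVec_mulVec]
  have h4 : star x ⬝ᵥ (Aᴴ * K) *ᵥ x + star x ⬝ᵥ K *ᵥ (A *ᵥ x) =
      star ((Bᴴ * K) *ᵥ x) ⬝ᵥ (Bᴴ * K) *ᵥ x := by
    rw [Matrix.mulVec_mulVec, ← dotProduct_add, ← Matrix.add_mulVec, hR, Matrix.star_mulVec,
      Matrix.conjTranspose_mul, Matrix.conjTranspose_conjTranspose, hK, ← Matrix.dotProduct_mulVec,
      Matrix.mulVec_mulVec, Matrix.mul_assoc]
  simp only [star_add, add_dotProduct, dotProduct_add, Matrix.mulVec_add, WithLp.ofLp_add]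
  rw [h1, h2, h3]
  linear_combination h4

/-- Only bounded horizons are possible at this stage: x is merely continuous and need not be
square-integrable on the half-line. -/
theorem memLp_deviation (K : Matrix (Fin n) (Fin n) ℂ) {u : ℝ → EuclideanSpace ℂ (Fin m)}
    {x : ℝ → Fin n → ℂ} (hx : ContinuousOn x (Ici 0)) (hu : MemLp u 2 (volume.restrict (Ici 0)))
    (T : ℝ) : MemLp (deviation B K u x) 2 (volume.restrict (Icc 0 T)) := by
  refine (memLp_Icc_of_memLp hu T).add ?_
  have h : Continuous fun w : Fin n → ℂ => WithLp.toLp 2 ((Bᴴ * K) *ᵥ w) :=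
    (PiLp.continuous_toLp 2 _).comp (Continuous.matrix_mulVec continuous_const continuous_id)
  have hc : ContinuousOn (fun t => WithLp.toLp 2 ((Bᴴ * K) *ᵥ x t)) (Icc 0 T) :=
    h.comp_continuousOn (hx.mono Icc_subset_Ici_self)
  obtain ⟨C, hC⟩ := isCompact_Icc.exists_bound_of_continuousOn hc
  exact MemLp.of_bound (hc.aestronglyMeasurable measurableSet_Icc) C
    ((ae_restrict_iff' measurableSet_Icc).2 (Eventually.of_forall hC))

/-- Completion of squares on a finite horizon. -/
theorem integral_deviation_eq {K : Matrix (Fin n) (Fin n) ℂ} (hK : Kᴴ = K)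
    (hR : Aᴴ * K + K * A = K * B * Bᴴ * K) {x₀ : Fin n → ℂ} {u : ℝ → EuclideanSpace ℂ (Fin m)}
    {x : ℝ → Fin n → ℂ} (hu : MemLp u 2 (volume.restrict (Ici 0)))
    (hx : IsTrajectory A B x₀ u x) {T : ℝ} (hT : 0 ≤ T) :
    ((∫ t in (0 : ℝ)..T, ‖deviation B K u x t‖ ^ 2 : ℝ) : ℂ) =
      ((∫ t in (0 : ℝ)..T, ‖u t‖ ^ 2 : ℝ) : ℂ) +
        (star (x T) ⬝ᵥ K *ᵥ x T - star x₀ ⬝ᵥ K *ᵥ x₀) := by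
  have h := integral_quadratic_form K hT (intervalIntegrable_rhs (A := A) (B := B) hx.1 hu hT) hx.2
  simp only [riccati_pointwise hK hR] at h
  have i1 : IntervalIntegrable (fun t => ‖u t‖ ^ 2) volume 0 T := by
    rw [intervalIntegrable_iff_integrableOn_Icc_of_le hT]
    exact integrable_sq (memLp_Icc_of_memLp hu T)
  have i2 : IntervalIntegrable (fun t => ‖deviation B K u x t‖ ^ 2) volume 0 T := by
    rw [intervalIntegrable_iff_integrableOn_Icc_of_le hT]
    exact integrable_sq (memLp_deviation K hx.1 hu T)
  rw [← h, ← intervalIntegral.integral_ofReal, ← intervalIntegral.integral_ofReal,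
    ← intervalIntegral.integral_add]
  · refine intervalIntegral.integral_congr fun t _ => ?_
    simp only [deviation]
    ring
  · rw [intervalIntegrable_iff] at *
    exact i1.ofReal
  · rw [intervalIntegrable_iff] at *
    exact i2.ofReal.sub i1.ofReal

theorem tendsto_integral_energy {u : ℝ → EuclideanSpace ℂ (Fin m)}
    (hu : MemLp u 2 (volume.restrict (Ici 0))) :
    Tendsto (fun T => ∫ t in (0 : ℝ)..T, ‖u t‖ ^ 2) atTop (𝓝 (energy u)) := by
  rw [energy, integral_Ici_eq_integral_Ioi]
  refine intervalIntegral_tendsto_integral_Ioi 0 ?_ tendsto_id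
  exact IntegrableOn.mono_set (integrable_sq hu) Ioi_subset_Ici_self

theorem tendsto_quadratic_form (K : Matrix (Fin n) (Fin n) ℂ) {x : ℝ → Fin n → ℂ}
    (hx : Tendsto x atTop (𝓝 0)) : Tendsto (fun T => star (x T) ⬝ᵥ K *ᵥ x T) atTop (𝓝 0) := by
  have h : Continuous fun w : Fin n → ℂ => star w ⬝ᵥ K *ᵥ w :=
    Continuous.dotProduct continuous_star
      (Continuous.matrix_mulVec continuous_const continuous_id)
  simpa [Function.comp_def] using (h.tendsto 0).comp hx

theorem quadratic_form_im {K : Matrix (Fin n) (Fin n) ℂ} (hK : Kᴴ = K) (x : Fin n → ℂ) :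
    (((star x ⬝ᵥ K *ᵥ x).re : ℝ) : ℂ) = star x ⬝ᵥ K *ᵥ x := by
  rw [← Complex.conj_eq_iff_re, ← Complex.star_def, ← Matrix.star_dotProduct_star, star_star,
    Matrix.star_mulVec, hK, ← Matrix.dotProduct_mulVec]

/-- Completion of squares on the infinite horizon. -/
theorem tendsto_integral_deviation {K : Matrix (Fin n) (Fin n) ℂ} (hK : Kᴴ = K)
    (hR : Aᴴ * K + K * A = K * B * Bᴴ * K) {x₀ : Fin n → ℂ} {u : ℝ → EuclideanSpace ℂ (Fin m)}
    {x : ℝ → Fin n → ℂ} (hu : MemLp u 2 (volume.restrict (Ici 0)))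
    (hx : IsTrajectory A B x₀ u x) (hx0 : Tendsto x atTop (𝓝 0)) :
    Tendsto (fun T => ∫ t in (0 : ℝ)..T, ‖deviation B K u x t‖ ^ 2) atTop
      (𝓝 (energy u - (star x₀ ⬝ᵥ K *ᵥ x₀).re)) := by
  have h : ∀ T, 0 ≤ T → ∫ t in (0 : ℝ)..T, ‖deviation B K u x t‖ ^ 2 =
      (∫ t in (0 : ℝ)..T, ‖u t‖ ^ 2) +
        ((star (x T) ⬝ᵥ K *ᵥ x T).re - (star x₀ ⬝ᵥ K *ᵥ x₀).re) := by
    intro T hT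
    have := congrArg Complex.re (integral_deviation_eq hK hR hu hx hT)
    simpa using this
  have h1 := Complex.continuous_re.continuousAt.tendsto.comp (tendsto_quadratic_form K hx0)
  have h2 := (tendsto_integral_energy hu).add (h1.sub_const (star x₀ ⬝ᵥ K *ᵥ x₀).re)
  rw [Complex.zero_re, zero_sub, ← sub_eq_add_neg] at h2
  exact h2.congr' ((eventually_ge_atTop 0).mono fun T hT => (h T hT).symm)

theorem integral_deviation_nonneg (K : Matrix (Fin n) (Fin n) ℂ)
    (u : ℝ → EuclideanSpace ℂ (Fin m)) (x : ℝ → Fin n → ℂ) {T : ℝ} (hT : 0 ≤ T) :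
    0 ≤ ∫ t in (0 : ℝ)..T, ‖deviation B K u x t‖ ^ 2 :=
  intervalIntegral.integral_nonneg hT fun _ _ => sq_nonneg _

theorem quadratic_form_le_energy {K : Matrix (Fin n) (Fin n) ℂ} (hK : Kᴴ = K)
    (hR : Aᴴ * K + K * A = K * B * Bᴴ * K) {x₀ : Fin n → ℂ} {u : ℝ → EuclideanSpace ℂ (Fin m)}
    (hu : u ∈ admissible A B x₀) : (star x₀ ⬝ᵥ K *ᵥ x₀).re ≤ energy u := by
  obtain ⟨hu, x, hx, hx0⟩ := hu
  have := ge_of_tendsto (tendsto_integral_deviation hK hR hu hx hx0)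
    ((eventually_ge_atTop 0).mono fun T hT => integral_deviation_nonneg K u x hT)
  linarith

/-- A control whose energy equals the value of the quadratic form obeys the feedback law. -/
theorem deviation_ae_eq_zero {K : Matrix (Fin n) (Fin n) ℂ} (hK : Kᴴ = K)
    (hR : Aᴴ * K + K * A = K * B * Bᴴ * K) {x₀ : Fin n → ℂ} {u : ℝ → EuclideanSpace ℂ (Fin m)}
    {x : ℝ → Fin n → ℂ} (hu : MemLp u 2 (volume.restrict (Ici 0)))
    (hx : IsTrajectory A B x₀ u x) (hx0 : Tendsto x atTop (𝓝 0))
    (he : energy u ≤ (star x₀ ⬝ᵥ K *ᵥ x₀).re) :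
    deviation B K u x =ᵐ[volume.restrict (Ici 0)] 0 := by
  have hlim := tendsto_integral_deviation hK hR hu hx hx0
  have hi : ∀ T, IntegrableOn (fun t => ‖deviation B K u x t‖ ^ 2) (Icc 0 T) := fun T =>
    integrable_sq (memLp_deviation K hx.1 hu T)
  have hz : ∀ N : ℕ, ∫ t in Icc (0 : ℝ) N, ‖deviation B K u x t‖ ^ 2 = 0 := by
    intro N
    have hN : (0 : ℝ) ≤ N := Nat.cast_nonneg N
    rw [integral_Icc_eq_integral_Ioc, ← intervalIntegral.integral_of_le hN]
    refine le_antisymm ?_ (integral_deviation_nonneg K u x hN)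
    -- The integral over [0, T] increases with T, so the one over [0, N] is at most the limit, which
    -- is nonpositive by `he`.
    refine (ge_of_tendsto hlim ((eventually_ge_atTop (N : ℝ)).mono fun T hT => ?_)).trans
      (sub_nonpos.2 he)
    rw [intervalIntegral.integral_of_le hN, intervalIntegral.integral_of_le (hN.trans hT)]
    exact setIntegral_mono_set ((hi T).mono_set Ioc_subset_Icc_self)
      (Eventually.of_forall fun _ => sq_nonneg _)
      (LE.le.eventuallyLE (Ioc_subset_Ioc_right hT))
  have hU : Ici (0 : ℝ) = ⋃ N : ℕ, Icc (0 : ℝ) N := by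
    ext t
    simp only [mem_Ici, mem_iUnion, mem_Icc, exists_and_left]
    exact ⟨fun h => ⟨h, exists_nat_ge t⟩, fun h => h.1⟩
  rw [hU, Filter.EventuallyEq, ae_restrict_iUnion_iff]
  intro N
  have := (integral_eq_zero_iff_of_nonneg (fun _ => sq_nonneg _) (hi N)).1 (hz N)
  filter_upwards [this] with t ht
  simpa using ht

end

/-! ### The infinite-horizon Gramian and its Lyapunov equation -/

section

variable {n m k : ℕ}

theorem re_pos_of_mem_spectrum_conjTranspose {J : Matrix (Fin k) (Fin k) ℂ}
    (hJ : ∀ z ∈ spectrum ℂ J, 0 < z.re) {z : ℂ} (hz : z ∈ spectrum ℂ Jᴴ) : 0 < z.re := by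
  have h : star z ∈ spectrum ℂ J := by
    rw [← Matrix.star_eq_conjTranspose, spectrum.map_star] at hz
    exact hz
  simpa using hJ _ h

theorem neg_mem_spectrum {J : Matrix (Fin k) (Fin k) ℂ} {z : ℂ} (hz : z ∈ spectrum ℂ (-J)) :
    -z ∈ spectrum ℂ J := by
  rw [← spectrum.neg_eq] at hz
  exact hz

/-- The matrix `e^{-Jt} C`. -/
def gramianFactor (J : Matrix (Fin k) (Fin k) ℂ) (C : Matrix (Fin k) (Fin m) ℂ) (t : ℝ)
    (i : Fin k) (l : Fin m) : ℂ :=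
  flow (-J) t (fun j => C j l) i

theorem gramianIntegrand_apply (J : Matrix (Fin k) (Fin k) ℂ) (C : Matrix (Fin k) (Fin m) ℂ)
    (t : ℝ) (i j : Fin k) : gramianIntegrand J C t i j =
      ∑ l, gramianFactor J C t i l * star (gramianFactor J C t j l) := by
  have h1 : NormedSpace.exp ((-t) • Jᴴ) = (NormedSpace.exp ((-t) • J))ᴴ := by
    rw [← Matrix.exp_conjTranspose, Matrix.conjTranspose_smul, star_trivial]
  have h2 : gramianIntegrand J C t =
      (NormedSpace.exp ((-t) • J) * C) * (NormedSpace.exp ((-t) • J) * C)ᴴ := by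
    rw [gramianIntegrand, h1, Matrix.conjTranspose_mul, Matrix.mul_assoc _ Cᴴ]
  rw [h2, Matrix.mul_apply]
  refine Finset.sum_congr rfl fun l _ => ?_
  rw [Matrix.conjTranspose_apply]
  have h3 : ∀ i, (NormedSpace.exp ((-t) • J) * C) i l = gramianFactor J C t i l := by
    intro i
    rw [gramianFactor, flow, smul_neg, neg_smul]
    rfl
  rw [h3, h3]

theorem hasDerivAt_gramianFactor (J : Matrix (Fin k) (Fin k) ℂ) (C : Matrix (Fin k) (Fin m) ℂ)
    (t : ℝ) (i : Fin k) (l : Fin m) : HasDerivAt (fun t => gramianFactor J C t i l)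
      (-∑ p, J i p * gramianFactor J C t p l) t := by
  have := hasDerivAt_pi.1 (hasDerivAt_flow (-J) (fun j => C j l) t) i
  rw [Matrix.neg_mulVec] at this
  exact this

theorem hasDerivAt_gramianIntegrand (J : Matrix (Fin k) (Fin k) ℂ) (C : Matrix (Fin k) (Fin m) ℂ)
    (t : ℝ) (i j : Fin k) : HasDerivAt (fun t => gramianIntegrand J C t i j)
      (-((∑ p, J i p * gramianIntegrand J C t p j) +
        ∑ p, gramianIntegrand J C t i p * star (J j p))) t := by
  simp only [gramianIntegrand_apply]
  have h : ∀ l ∈ Finset.univ, HasDerivAt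
      (fun t => gramianFactor J C t i l * star (gramianFactor J C t j l))
      ((-∑ p, J i p * gramianFactor J C t p l) * star (gramianFactor J C t j l) +
        gramianFactor J C t i l * star (-∑ p, J j p * gramianFactor J C t p l)) t := fun l _ =>
    (hasDerivAt_gramianFactor J C t i l).mul (hasDerivAt_gramianFactor J C t j l).star
  refine (HasDerivAt.fun_sum h).congr_deriv ?_
  simp only [star_neg, star_sum, star_mul', neg_mul, mul_neg, Finset.sum_add_distrib,
    Finset.sum_neg_distrib, Finset.mul_sum, Finset.sum_mul]
  rw [Finset.sum_comm, Finset.sum_comm (γ := Fin m), neg_add]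
  congr 2 <;>
  · congr 1
    ext1 p
    refine Finset.sum_congr rfl fun l _ => ?_
    ring

theorem expDecay_neg {J : Matrix (Fin k) (Fin k) ℂ} (hJ : ∀ z ∈ spectrum ℂ J, 0 < z.re)
    (v : Fin k → ℂ) : ExpDecay (-J) v := by
  have : IsHurwitz (-J) := fun z hz => by simpa using hJ _ (neg_mem_spectrum hz)
  refine expDecay_of_mem_stableSubspace ?_
  rw [stableSubspace_eq_top this]
  trivial

theorem integrableOn_mul_star_of_expDecay {M : Matrix (Fin k) (Fin k) ℂ} {v : Fin k → ℂ}
    (hv : ExpDecay M v) (i j : Fin k) :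
    IntegrableOn (fun t => flow M t v i * star (flow M t v j)) (Ici 0) := by
  obtain ⟨c, hc, C, hC⟩ := hv
  have hcont : ∀ i, Continuous fun t => flow M t v i := fun i =>
    (continuous_apply i).comp (continuous_flow M v)
  refine ((integrable_exp_neg_mul (c := c + c) (by positivity)).const_mul (C * C)).mono'
    ((hcont i).mul (hcont j).star).aestronglyMeasurable.restrict
    ((ae_restrict_iff' measurableSet_Ici).2 (Eventually.of_forall fun t ht => ?_))
  rw [norm_mul, norm_star, neg_add, add_mul, Real.exp_add, mul_mul_mul_comm]
  have h : ∀ i, ‖flow M t v i‖ ≤ C * Real.exp (-c * t) := fun i =>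
    (norm_le_pi_norm _ i).trans (hC t ht)
  exact mul_le_mul (h i) (h j) (norm_nonneg _) ((norm_nonneg _).trans (h i))

theorem integrableOn_gramianIntegrand {J : Matrix (Fin k) (Fin k) ℂ}
    (hJ : ∀ z ∈ spectrum ℂ J, 0 < z.re) (C : Matrix (Fin k) (Fin m) ℂ) (i j : Fin k) :
    IntegrableOn (fun t => gramianIntegrand J C t i j) (Ici 0) := by
  simp only [gramianIntegrand_apply]
  exact integrable_finsetSum _ fun l _ => integrableOn_mul_star_of_expDecay (expDecay_neg hJ _) i j

theorem tendsto_gramianIntegrand {J : Matrix (Fin k) (Fin k) ℂ}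
    (hJ : ∀ z ∈ spectrum ℂ J, 0 < z.re) (C : Matrix (Fin k) (Fin m) ℂ) (i j : Fin k) :
    Tendsto (fun t => gramianIntegrand J C t i j) atTop (𝓝 0) := by
  simp only [gramianIntegrand_apply]
  have h : ∀ i l, Tendsto (fun t => gramianFactor J C t i l) atTop (𝓝 0) := fun i l =>
    tendsto_pi_nhds.1 (expDecay_neg hJ _).tendsto i
  have := tendsto_finsetSum (Finset.univ : Finset (Fin m)) fun l _ =>
    (h i l).mul ((h j l).star)
  simpa using this

theorem conjTranspose_gramianInfty (J : Matrix (Fin k) (Fin k) ℂ) (C : Matrix (Fin k) (Fin m) ℂ) :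
    (gramianInfty J C)ᴴ = gramianInfty J C := by
  ext i j
  simp only [Matrix.conjTranspose_apply, gramianInfty, Matrix.of_apply, Complex.star_def]
  rw [← integral_conj]
  congr 1
  ext1 t
  rw [gramianIntegrand_apply, gramianIntegrand_apply, map_sum]
  refine Finset.sum_congr rfl fun l _ => ?_
  rw [← Complex.star_def, star_mul', star_star, mul_comm]

/-- The Lyapunov equation for the Gramian. -/
theorem gramianInfty_lyapunov {J : Matrix (Fin k) (Fin k) ℂ}
    (hJ : ∀ z ∈ spectrum ℂ J, 0 < z.re) (C : Matrix (Fin k) (Fin m) ℂ) :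
    J * gramianInfty J C + gramianInfty J C * Jᴴ = C * Cᴴ := by
  ext i j
  have hi : ∀ p q, Integrable (fun t => gramianIntegrand J C t p q) (volume.restrict (Ici 0)) :=
    integrableOn_gramianIntegrand hJ C
  have i1 : Integrable (fun t => ∑ p, J i p * gramianIntegrand J C t p j)
      (volume.restrict (Ici 0)) :=
    integrable_finsetSum _ fun p _ => (hi p j).const_mul _
  have i2 : Integrable (fun t => ∑ p, gramianIntegrand J C t i p * star (J j p))
      (volume.restrict (Ici 0)) :=
    integrable_finsetSum _ fun p _ => (hi i p).mul_const _
  have h := integral_Ioi_of_hasDerivAt_of_tendsto' (a := 0)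
    (fun t _ => hasDerivAt_gramianIntegrand J C t i j)
    (IntegrableOn.mono_set (i1.add i2).neg Ioi_subset_Ici_self) (tendsto_gramianIntegrand hJ C i j)
  have h0 : gramianIntegrand J C 0 i j = (C * Cᴴ) i j := by simp [gramianIntegrand]
  rw [← integral_Ici_eq_integral_Ioi, integral_neg, integral_add i1 i2, h0, zero_sub, neg_inj,
    integral_finsetSum _ fun p _ => (hi p j).const_mul _,
    integral_finsetSum _ fun p _ => (hi i p).mul_const _] at h
  rw [← h, Matrix.add_apply, Matrix.mul_apply, Matrix.mul_apply]
  simp only [gramianInfty, Matrix.of_apply, Matrix.conjTranspose_apply, integral_const_mul,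
    integral_mul_const]

/-- Positive-definiteness of the Gramian in the form needed here: it is nonsingular as soon as `J†`
has no eigenvector in the kernel of `C†`. -/
theorem isUnit_of_lyapunov {J W : Matrix (Fin k) (Fin k) ℂ} {C : Matrix (Fin k) (Fin m) ℂ}
    (hW : Wᴴ = W) (hL : J * W + W * Jᴴ = C * Cᴴ)
    (hC : ∀ (z : ℂ) (v : Fin k → ℂ), Jᴴ *ᵥ v = z • v → Cᴴ *ᵥ v = 0 → v = 0) : IsUnit W := by
  -- Sandwiching the Lyapunov equation between v† and v gives ‖C†v‖² = 0.
  have h1 : ∀ v, W *ᵥ v = 0 → Cᴴ *ᵥ v = 0 := by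
    intro v hv
    have hv' : star v ᵥ* W = 0 := by
      have := congrArg star hv
      rwa [Matrix.star_mulVec, hW, star_zero] at this
    have e : star (Cᴴ *ᵥ v) ⬝ᵥ (Cᴴ *ᵥ v) = 0 := by
      rw [Matrix.star_mulVec, Matrix.conjTranspose_conjTranspose, ← Matrix.dotProduct_mulVec,
        Matrix.mulVec_mulVec, ← hL, Matrix.add_mulVec, ← Matrix.mulVec_mulVec,
        ← Matrix.mulVec_mulVec, hv, Matrix.mulVec_zero, zero_add, Matrix.dotProduct_mulVec, hv',
        zero_dotProduct]
    open scoped ComplexOrder in exact dotProduct_star_self_eq_zero.1 e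
  have h2 : ∀ v, W *ᵥ v = 0 → W *ᵥ (Jᴴ *ᵥ v) = 0 := by
    intro v hv
    have := congrArg (· *ᵥ v) hL
    simpa [Matrix.add_mulVec, ← Matrix.mulVec_mulVec, hv, h1 v hv] using this
  rw [← Matrix.mulVec_injective_iff_isUnit]
  by_contra hinj
  -- The kernel of W is invariant under J†; were it nonzero, it would contain an eigenvector of J†,
  -- and that vector is annihilated by C†.
  let N : Submodule ℂ (Fin k → ℂ) := LinearMap.ker (Matrix.toLin' W)
  have hmem : ∀ v, v ∈ N ↔ W *ᵥ v = 0 := fun v => by simp [N]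
  have hN : N ≠ ⊥ := fun h => hinj (by
    have := LinearMap.ker_eq_bot.1 h
    exact this)
  have : Nontrivial N := Submodule.nontrivial_iff_ne_bot.2 hN
  let f : Module.End ℂ N := (Matrix.toLin' Jᴴ).restrict (p := N) (q := N) fun v hv => by
    rw [hmem] at *
    exact h2 v hv
  obtain ⟨z, hz⟩ := Module.End.exists_eigenvalue f
  obtain ⟨v, hv⟩ := hz.exists_hasEigenvector
  have e : Jᴴ *ᵥ (v : Fin k → ℂ) = z • (v : Fin k → ℂ) := by
    have := congrArg Subtype.val hv.apply_eq_smul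
    simpa [f] using! this
  exact hv.2 (Subtype.ext (hC z v e (h1 v ((hmem v).1 v.2))))

end

/-! ### The spectral splitting, the matrix K and the closed loop -/

section

variable {n m : ℕ} {A : Matrix (Fin n) (Fin n) ℂ}

namespace SpectralSplitting

/-- The unstable coordinates. -/
def proj (S : SpectralSplitting A) : Matrix (Fin S.nu) (Fin n) ℂ :=
  S.P⁻¹.submatrix (fun i => S.e (Sum.inl i)) id

/-- The inclusion of the complementary coordinates. -/
def incl (S : SpectralSplitting A) : Matrix (Fin n) (Fin S.ns) ℂ :=
  S.P.submatrix id (fun i => S.e (Sum.inr i))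

/-- The inclusion of the unstable coordinates. -/
def inclU (S : SpectralSplitting A) : Matrix (Fin n) (Fin S.nu) ℂ :=
  S.P.submatrix id (fun i => S.e (Sum.inl i))

variable (S : SpectralSplitting A)

theorem inv_mul_P : S.P⁻¹ * S.P = 1 :=
  Matrix.nonsing_inv_mul _ ((Matrix.isUnit_iff_isUnit_det _).1 S.isUnit_P)

theorem P_mul_inv : S.P * S.P⁻¹ = 1 :=
  Matrix.mul_nonsing_inv _ ((Matrix.isUnit_iff_isUnit_det _).1 S.isUnit_P)

theorem proj_mul : S.proj * A = S.Ju * S.proj := by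
  have h : S.P⁻¹ * A = Matrix.reindex S.e S.e (Matrix.fromBlocks S.Ju 0 0 S.Js) * S.P⁻¹ := by
    rw [← S.conj_eq, Matrix.mul_assoc _ S.P, S.P_mul_inv, Matrix.mul_one]
  ext i j
  have := congrFun (congrFun h (S.e (Sum.inl i))) j
  rw [Matrix.mul_apply, Matrix.mul_apply, ← S.e.sum_comp (fun q => _ * S.P⁻¹ q j),
    Fintype.sum_sum_type] at this
  simpa [Matrix.mul_apply, proj] using this

theorem mul_incl : A * S.incl = S.incl * S.Js := by
  have h : A * S.P = S.P * Matrix.reindex S.e S.e (Matrix.fromBlocks S.Ju 0 0 S.Js) := by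
    rw [← S.conj_eq, ← Matrix.mul_assoc, ← Matrix.mul_assoc, S.P_mul_inv, Matrix.one_mul]
  ext i j
  have := congrFun (congrFun h i) (S.e (Sum.inr j))
  rw [Matrix.mul_apply, Matrix.mul_apply, ← S.e.sum_comp (fun q => S.P i q * _),
    Fintype.sum_sum_type] at this
  simpa [Matrix.mul_apply, incl] using this

theorem proj_mul_inclU : S.proj * S.inclU = 1 := by
  ext i j
  have := congrFun (congrFun S.inv_mul_P (S.e (Sum.inl i))) (S.e (Sum.inl j))
  rw [Matrix.mul_apply] at this
  simpa [Matrix.mul_apply, proj, inclU, Matrix.one_apply] using this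

theorem exists_eq_incl_mulVec {x : Fin n → ℂ} (hx : S.proj *ᵥ x = 0) :
    ∃ y, x = S.incl *ᵥ y := by
  refine ⟨fun i => (S.P⁻¹ *ᵥ x) (S.e (Sum.inr i)), ?_⟩
  have h : S.P *ᵥ (S.P⁻¹ *ᵥ x) = x := by
    rw [Matrix.mulVec_mulVec, S.P_mul_inv, Matrix.one_mulVec]
  have h0 : ∀ i, (S.P⁻¹ *ᵥ x) (S.e (Sum.inl i)) = 0 := fun i => congrFun hx i
  generalize S.P⁻¹ *ᵥ x = w at *
  ext j
  rw [← h, Matrix.mulVec, dotProduct, ← S.e.sum_comp, Fintype.sum_sum_type]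
  simp [h0, Matrix.mulVec, dotProduct, incl]

theorem Cu_eq (B : Matrix (Fin n) (Fin m) ℂ) : S.Cu B = S.proj * B := by
  ext i j
  simp [Cu, proj, Matrix.mul_apply]

/-- This form shows that K sees only the unstable coordinates and removes the block matrices from
the later algebra. -/
theorem K_eq (B : Matrix (Fin n) (Fin m) ℂ) : S.K B = S.projᴴ * (S.Wu B)⁻¹ * S.proj := by
  have h : Matrix.reindex S.e S.e (Matrix.fromBlocks (S.Wu B)⁻¹ 0 0 0) * S.P⁻¹ =
      Matrix.of fun i j => Sum.elim (fun p => ((S.Wu B)⁻¹ * S.proj) p j) (fun _ => 0)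
        (S.e.symm i) := by
    ext i j
    obtain ⟨i, rfl⟩ := S.e.surjective i
    rw [Matrix.mul_apply, ← S.e.sum_comp, Fintype.sum_sum_type]
    rcases i with i | i <;> simp [Matrix.mul_apply, proj]
  rw [K, Matrix.mul_assoc, h, Matrix.mul_assoc]
  ext i j
  rw [Matrix.mul_apply, ← S.e.sum_comp, Fintype.sum_sum_type, Matrix.mul_apply]
  simp [proj]

theorem conjTranspose_Wu (B : Matrix (Fin n) (Fin m) ℂ) : (S.Wu B)ᴴ = S.Wu B :=
  conjTranspose_gramianInfty _ _

theorem lyapunov (B : Matrix (Fin n) (Fin m) ℂ) :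
    S.Ju * S.Wu B + S.Wu B * S.Juᴴ = S.proj * B * (S.proj * B)ᴴ := by
  rw [← Cu_eq]
  exact gramianInfty_lyapunov S.re_pos _

/-- A Hautus argument: an eigenvector v of J_u† annihilated by C_u† yields an eigenvector T†v of A†
annihilated by B†, with T the unstable projection. No feedback can move its eigenvalue, so A + BF
keeps an eigenvalue with positive real part. -/
theorem isUnit_Wu {B : Matrix (Fin n) (Fin m) ℂ} (hAB : Stabilizable A B) : IsUnit (S.Wu B) := by
  refine isUnit_of_lyapunov (S.conjTranspose_Wu B) (S.lyapunov B) fun z v hz hv => ?_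
  by_contra hv0
  obtain ⟨F, hF⟩ := hAB
  have h1 : 0 < z.re :=
    re_pos_of_mem_spectrum_conjTranspose S.re_pos (mem_spectrum_of_mulVec_eq_smul hv0 hz)
  have hw0 : S.projᴴ *ᵥ v ≠ 0 := by
    intro h
    have : S.inclUᴴ *ᵥ (S.projᴴ *ᵥ v) = v := by
      rw [Matrix.mulVec_mulVec, ← Matrix.conjTranspose_mul, S.proj_mul_inclU,
        Matrix.conjTranspose_one, Matrix.one_mulVec]
    rw [h, Matrix.mulVec_zero] at this
    exact hv0 this.symm
  have hw : (A + B * F)ᴴ *ᵥ (S.projᴴ *ᵥ v) = z • (S.projᴴ *ᵥ v) := by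
    have e1 : Aᴴ * S.projᴴ = S.projᴴ * S.Juᴴ := by
      rw [← Matrix.conjTranspose_mul, S.proj_mul, Matrix.conjTranspose_mul]
    have e2 : Bᴴ *ᵥ (S.projᴴ *ᵥ v) = 0 := by
      rwa [Matrix.mulVec_mulVec, ← Matrix.conjTranspose_mul]
    rw [Matrix.conjTranspose_add, Matrix.add_mulVec, Matrix.conjTranspose_mul,
      ← Matrix.mulVec_mulVec _ Fᴴ, e2, Matrix.mulVec_zero, add_zero, Matrix.mulVec_mulVec, e1,
      ← Matrix.mulVec_mulVec, hz, Matrix.mulVec_smul]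
  have h2 := mem_spectrum_of_mulVec_eq_smul hw0 hw
  rw [← Matrix.star_eq_conjTranspose, spectrum.map_star] at h2
  have h3 : (star z).re < 0 := hF _ h2
  rw [Complex.star_def, Complex.conj_re] at h3
  linarith

theorem conjTranspose_K (B : Matrix (Fin n) (Fin m) ℂ) : (S.K B)ᴴ = S.K B := by
  rw [K_eq]
  simp only [Matrix.conjTranspose_mul, Matrix.conjTranspose_conjTranspose,
    Matrix.conjTranspose_nonsing_inv, conjTranspose_Wu, Matrix.mul_assoc]

variable {B : Matrix (Fin n) (Fin m) ℂ}

theorem inv_mul_Wu (hW : IsUnit (S.Wu B)) : (S.Wu B)⁻¹ * S.Wu B = 1 :=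
  Matrix.nonsing_inv_mul _ ((Matrix.isUnit_iff_isUnit_det _).1 hW)

theorem Wu_mul_inv (hW : IsUnit (S.Wu B)) : S.Wu B * (S.Wu B)⁻¹ = 1 :=
  Matrix.mul_nonsing_inv _ ((Matrix.isUnit_iff_isUnit_det _).1 hW)

theorem lyapunov_inv (hW : IsUnit (S.Wu B)) :
    (S.Wu B)⁻¹ * S.Ju + S.Juᴴ * (S.Wu B)⁻¹ =
      (S.Wu B)⁻¹ * (S.proj * B * (S.proj * B)ᴴ) * (S.Wu B)⁻¹ := by
  have h1 : (S.Wu B)⁻¹ * (S.Ju * S.Wu B) * (S.Wu B)⁻¹ = (S.Wu B)⁻¹ * S.Ju := by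
    rw [Matrix.mul_assoc, Matrix.mul_assoc S.Ju, S.Wu_mul_inv hW, Matrix.mul_one]
  have h2 : (S.Wu B)⁻¹ * (S.Wu B * S.Juᴴ) * (S.Wu B)⁻¹ = S.Juᴴ * (S.Wu B)⁻¹ := by
    rw [← Matrix.mul_assoc, S.inv_mul_Wu hW, Matrix.one_mul]
  rw [← S.lyapunov B, Matrix.mul_add, Matrix.add_mul, h1, h2]

/-- `K` solves the algebraic Riccati equation. -/
theorem riccati (hW : IsUnit (S.Wu B)) :
    Aᴴ * S.K B + S.K B * A = S.K B * B * Bᴴ * S.K B := by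
  have e1 : Aᴴ * S.projᴴ = S.projᴴ * S.Juᴴ := by
    rw [← Matrix.conjTranspose_mul, S.proj_mul, Matrix.conjTranspose_mul]
  have e2 : Aᴴ * S.K B = S.projᴴ * (S.Juᴴ * (S.Wu B)⁻¹) * S.proj := by
    rw [K_eq, ← Matrix.mul_assoc, ← Matrix.mul_assoc, e1]
    simp only [Matrix.mul_assoc]
  have e3 : S.K B * A = S.projᴴ * ((S.Wu B)⁻¹ * S.Ju) * S.proj := by
    rw [K_eq, Matrix.mul_assoc, S.proj_mul]
    simp only [Matrix.mul_assoc]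
  rw [e2, e3, ← Matrix.add_mul, ← Matrix.mul_add, add_comm, S.lyapunov_inv hW, K_eq]
  simp only [Matrix.mul_assoc, Matrix.conjTranspose_mul]

/-- By the inverted Lyapunov equation, feedback replaces W⁻¹J_u by W⁻¹J_u − (W⁻¹J_u + J_u†W⁻¹) =
−J_u†W⁻¹: the unstable eigenvalues are reflected across the imaginary axis. -/
theorem intertwine_closedLoop (hW : IsUnit (S.Wu B)) :
    ((S.Wu B)⁻¹ * S.proj) * (A - B * Bᴴ * S.K B) = (-S.Juᴴ) * ((S.Wu B)⁻¹ * S.proj) := by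
  have h1 : (S.Wu B)⁻¹ * S.proj * A = (S.Wu B)⁻¹ * S.Ju * S.proj := by
    rw [Matrix.mul_assoc, S.proj_mul, Matrix.mul_assoc]
  have h2 : (S.Wu B)⁻¹ * S.proj * (B * Bᴴ * S.K B) =
      ((S.Wu B)⁻¹ * S.Ju + S.Juᴴ * (S.Wu B)⁻¹) * S.proj := by
    rw [S.lyapunov_inv hW, K_eq]
    simp only [Matrix.mul_assoc, Matrix.conjTranspose_mul]
  rw [Matrix.mul_sub, h1, h2, Matrix.add_mul, Matrix.neg_mul, Matrix.mul_assoc S.Juᴴ]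
  abel

/-- The intertwiner would carry a generalized eigenvector with Re z ≥ 0 to one of −J_u†, which has
only eigenvalues with negative real part; so its image is 0. -/
theorem proj_mulVec_eq_zero (hW : IsUnit (S.Wu B)) {r : Fin n → ℂ}
    (hr : r ∈ antistableSubspace (A - B * Bᴴ * S.K B)) : S.proj *ᵥ r = 0 := by
  have h : antistableSubspace (A - B * Bᴴ * S.K B) ≤ LinearMap.ker (Matrix.toLin' S.proj) := by
    refine iSup_le fun z v hv => ?_
    have hm := mulVec_mem_maxGenEigenspace (S.intertwine_closedLoop hW) hv
    have h0 : ((S.Wu B)⁻¹ * S.proj) *ᵥ v = 0 := by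
      by_contra h0
      have h1 := re_pos_of_mem_spectrum_conjTranspose S.re_pos
        (neg_mem_spectrum (mem_spectrum_of_mem_maxGenEigenspace h0 hm))
      rw [Complex.neg_re] at h1
      linarith [z.2]
    have h2 := congrArg (S.Wu B *ᵥ ·) h0
    simp only [Matrix.mulVec_mulVec, Matrix.mulVec_zero] at h2
    rw [← Matrix.mul_assoc, S.Wu_mul_inv hW, Matrix.one_mul] at h2
    simpa using h2
  simpa using h hr

theorem K_mulVec_eq_zero {r : Fin n → ℂ} (hr : S.proj *ᵥ r = 0) : S.K B *ᵥ r = 0 := by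
  rw [K_eq, ← Matrix.mulVec_mulVec, hr, Matrix.mulVec_zero]

theorem incl_mulVec_mem (y : Fin S.ns → ℂ) : S.incl *ᵥ y ∈
    ⨆ z : {z : ℂ // z.re ≤ 0}, Module.End.maxGenEigenspace (Matrix.toLin' A) z.1 := by
  have hy : y ∈ ⨆ z, Module.End.maxGenEigenspace (Matrix.toLin' S.Js) z := by
    rw [iSup_maxGenEigenspace_toLin']; trivial
  refine (iSup_le fun z w hw => ?_ : _ ≤ Submodule.comap (Matrix.toLin' S.incl)
    (⨆ z : {z : ℂ // z.re ≤ 0}, Module.End.maxGenEigenspace (Matrix.toLin' A) z.1)) hy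
  by_cases h0 : w = 0
  · rw [h0]; exact Submodule.zero_mem _
  · exact Submodule.mem_iSup_of_mem
      (p := fun z : {z : ℂ // z.re ≤ 0} => Module.End.maxGenEigenspace (Matrix.toLin' A) z.1)
      ⟨z, S.re_nonpos z (mem_spectrum_of_mem_maxGenEigenspace h0 hw)⟩
      (mulVec_mem_maxGenEigenspace S.mul_incl.symm hw)

theorem optimalCost_eq_zero (hAB : Stabilizable A B) {r : Fin n → ℂ} (hr : S.proj *ᵥ r = 0) :
    optimalCost A B r = 0 := by
  obtain ⟨y, rfl⟩ := S.exists_eq_incl_mulVec hr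
  exact optimalCost_eq_zero_of_mem_iSup hAB.admissible_nonempty (S.incl_mulVec_mem y)

end SpectralSplitting

/-! ### Attainment, uniqueness and the value of the infimum -/

variable {B : Matrix (Fin n) (Fin m) ℂ}

theorem closedLoop_eq (K : Matrix (Fin n) (Fin n) ℂ) :
    A + B * (-(Bᴴ * K)) = A - B * Bᴴ * K := by
  rw [Matrix.mul_neg, ← sub_eq_add_neg, Matrix.mul_assoc]

theorem isTrajectory_closedLoop (K : Matrix (Fin n) (Fin n) ℂ) (x₀ : Fin n → ℂ) :
    IsTrajectory A B x₀ (feedback A B (-(Bᴴ * K)) x₀)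
      (fun t => flow (A - B * Bᴴ * K) t x₀) := by
  have := isTrajectory_feedback (A := A) (B := B) (-(Bᴴ * K)) x₀
  rwa [closedLoop_eq] at this

theorem feedback_apply (K : Matrix (Fin n) (Fin n) ℂ) (x₀ : Fin n → ℂ) (t : ℝ) :
    feedback A B (-(Bᴴ * K)) x₀ t =
      WithLp.toLp 2 (-((Bᴴ * K) *ᵥ flow (A - B * Bᴴ * K) t x₀)) := by
  rw [feedback, closedLoop_eq, Matrix.neg_mulVec]

theorem closedLoop_mem_admissible {K : Matrix (Fin n) (Fin n) ℂ} {x₀ : Fin n → ℂ}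
    (h : x₀ ∈ stableSubspace (A - B * Bᴴ * K)) :
    feedback A B (-(Bᴴ * K)) x₀ ∈ admissible A B x₀ :=
  feedback_mem_admissible (by rwa [closedLoop_eq])

theorem energy_closedLoop {K : Matrix (Fin n) (Fin n) ℂ} (hK : Kᴴ = K)
    (hR : Aᴴ * K + K * A = K * B * Bᴴ * K) {x₀ : Fin n → ℂ}
    (h : x₀ ∈ stableSubspace (A - B * Bᴴ * K)) :
    energy (feedback A B (-(Bᴴ * K)) x₀) = (star x₀ ⬝ᵥ K *ᵥ x₀).re := by
  have hlim := tendsto_integral_deviation hK hR (closedLoop_mem_admissible h).1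
    (isTrajectory_closedLoop K x₀) (expDecay_of_mem_stableSubspace h).tendsto
  have h0 : ∀ t, deviation B K (feedback A B (-(Bᴴ * K)) x₀)
      (fun t => flow (A - B * Bᴴ * K) t x₀) t = 0 := by
    intro t
    rw [deviation, feedback_apply, ← WithLp.toLp_add, neg_add_cancel, WithLp.toLp_zero]
  simp only [h0, norm_zero, ne_eq, OfNat.ofNat_ne_zero, not_false_eq_true, zero_pow,
    intervalIntegral.integral_zero] at hlim
  linarith [tendsto_nhds_unique hlim tendsto_const_nhds]

/-- A trajectory whose control obeys the feedback law almost everywhere is the closed-loop flow. -/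
theorem IsTrajectory.eq_flow_of_deviation {K : Matrix (Fin n) (Fin n) ℂ} {x₀ : Fin n → ℂ}
    {u : ℝ → EuclideanSpace ℂ (Fin m)} {x : ℝ → Fin n → ℂ} (hx : IsTrajectory A B x₀ u x)
    (h : deviation B K u x =ᵐ[volume.restrict (Ici 0)] 0) {t : ℝ} (ht : 0 ≤ t) :
    x t = flow (A - B * Bᴴ * K) t x₀ := by
  refine eq_flow_of_integral_eq _ _ x hx.1 (fun t ht => ?_) ht
  rw [hx.2 t ht]
  congr 1
  refine intervalIntegral.integral_congr_ae ?_
  rw [Filter.EventuallyEq, ae_restrict_iff' measurableSet_Ici] at h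
  filter_upwards [h] with s hs hst
  rw [uIoc_of_le ht] at hst
  have hu : u s = WithLp.toLp 2 (-((Bᴴ * K) *ᵥ x s)) := by
    rw [WithLp.toLp_neg]
    exact eq_neg_of_add_eq_zero_left (hs hst.1.le)
  rw [hu, WithLp.ofLp_toLp, Matrix.mulVec_neg, Matrix.mulVec_mulVec, ← sub_eq_add_neg,
    Matrix.sub_mulVec, Matrix.mul_assoc]

/-- The closed-loop antistable part r of x₀ contributes neither to the infimal cost nor, as Kr = 0,
to the quadratic form; on the stable part the feedback realizes the form. With the lower bound, this
identifies the infimum for every x₀. -/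
theorem SpectralSplitting.optimalCost_le_quadratic_form (S : SpectralSplitting A)
    (hAB : Stabilizable A B) (x₀ : Fin n → ℂ) :
    optimalCost A B x₀ ≤ (star x₀ ⬝ᵥ S.K B *ᵥ x₀).re := by
  have hW := S.isUnit_Wu hAB
  have hK := S.conjTranspose_K B
  obtain ⟨v, hv, r, hr, rfl⟩ := exists_stable_add_antistable (A - B * Bᴴ * S.K B) x₀
  have hr0 := S.proj_mulVec_eq_zero hW hr
  have hKr : S.K B *ᵥ r = 0 := S.K_mulVec_eq_zero hr0
  have hrK : star r ᵥ* S.K B = 0 := by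
    have := congrArg star hKr
    rwa [Matrix.star_mulVec, hK, star_zero] at this
  refine (optimalCost_add_le_of_eq_zero hAB.admissible_nonempty v
    (S.optimalCost_eq_zero hAB hr0)).trans ?_
  refine (optimalCost_le (closedLoop_mem_admissible hv)).trans (le_of_eq ?_)
  rw [energy_closedLoop hK (S.riccati hW) hv, Matrix.mulVec_add, hKr, add_zero, star_add,
    add_dotProduct, Matrix.dotProduct_mulVec (star r), hrK, zero_dotProduct, add_zero]

/-- The energy of a minimizer is the infimum, hence at most x₀†Kx₀, which leaves no room for the
square in the completed form. -/
theorem SpectralSplitting.isMinimizer_deviation (S : SpectralSplitting A)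
    (hAB : Stabilizable A B) {x₀ : Fin n → ℂ} {u : ℝ → EuclideanSpace ℂ (Fin m)}
    (hu : IsMinimizer A B x₀ u) {x : ℝ → Fin n → ℂ} (hx : IsTrajectory A B x₀ u x)
    (hx0 : Tendsto x atTop (𝓝 0)) :
    deviation B (S.K B) u x =ᵐ[volume.restrict (Ici 0)] 0 := by
  refine deviation_ae_eq_zero (S.conjTranspose_K B) (S.riccati (S.isUnit_Wu hAB)) hu.1.1 hx hx0 ?_
  refine le_trans ?_ (S.optimalCost_le_quadratic_form hAB x₀)
  refine le_csInf ⟨_, u, hu.1, rfl⟩ ?_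
  rintro _ ⟨v, hv, rfl⟩
  exact hu.2 v hv

theorem SpectralSplitting.mem_stableSubspace_of_isMinimizer (S : SpectralSplitting A)
    (hAB : Stabilizable A B) {x₀ : Fin n → ℂ} {u : ℝ → EuclideanSpace ℂ (Fin m)}
    (hu : IsMinimizer A B x₀ u) : x₀ ∈ stableSubspace (A - B * Bᴴ * S.K B) := by
  obtain ⟨-, x, hx, hx0⟩ := hu.1
  have h := S.isMinimizer_deviation hAB hu hx hx0
  exact mem_stableSubspace_of_tendsto (hx0.congr' ((eventually_ge_atTop 0).mono fun t ht =>
    hx.eq_flow_of_deviation h ht))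

theorem SpectralSplitting.isMinimizer_feedback (S : SpectralSplitting A)
    (hAB : Stabilizable A B) {x₀ : Fin n → ℂ}
    (h : x₀ ∈ stableSubspace (A - B * Bᴴ * S.K B)) :
    IsMinimizer A B x₀ (feedback A B (-(Bᴴ * S.K B)) x₀) := by
  have hR := S.riccati (S.isUnit_Wu hAB)
  refine ⟨closedLoop_mem_admissible h, fun v hv => ?_⟩
  rw [energy_closedLoop (S.conjTranspose_K B) hR h]
  exact quadratic_form_le_energy (S.conjTranspose_K B) hR hv

theorem SpectralSplitting.isMinimizer_unique (S : SpectralSplitting A)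
    (hAB : Stabilizable A B) {x₀ : Fin n → ℂ} {v : ℝ → EuclideanSpace ℂ (Fin m)}
    (hv : IsMinimizer A B x₀ v) :
    v =ᵐ[volume.restrict (Ici 0)] feedback A B (-(Bᴴ * S.K B)) x₀ := by
  obtain ⟨-, x, hx, hx0⟩ := hv.1
  have h := S.isMinimizer_deviation hAB hv hx hx0
  filter_upwards [h, ae_restrict_mem measurableSet_Ici] with t ht ht0
  rw [feedback_apply, ← hx.eq_flow_of_deviation h ht0, WithLp.toLp_neg]
  exact eq_neg_of_add_eq_zero_left ht

end

end MinEnergy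

end

theorem theorem3 {n m : ℕ} (A : Matrix (Fin n) (Fin n) ℂ) (B : Matrix (Fin n) (Fin m) ℂ)
    (hAB : MinEnergy.Stabilizable A B) (S : MinEnergy.SpectralSplitting A) (x₀ : Fin n → ℂ) :
    -- the matrix `K` is well defined: the Gramian converges and is nonsingular
    (∀ i j, IntegrableOn (fun t => MinEnergy.gramianIntegrand S.Ju (S.Cu B) t i j) (Ici 0)) ∧
    IsUnit (S.Wu B) ∧
    -- solvability
    ((∃ u, MinEnergy.IsMinimizer A B x₀ u) ↔
      x₀ ∈ MinEnergy.stableSubspace (A - B * B.conjTranspose * S.K B)) ∧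
    -- the minimal cost, and the unique minimizer, in feedback form
    (x₀ ∈ MinEnergy.stableSubspace (A - B * B.conjTranspose * S.K B) →
      ∃ (u : ℝ → EuclideanSpace ℂ (Fin m)) (x : ℝ → Fin n → ℂ),
        MinEnergy.IsMinimizer A B x₀ u ∧
        MinEnergy.IsTrajectory A B x₀ u x ∧
        (∀ t : ℝ, 0 ≤ t →
          u t = WithLp.toLp 2 (-((B.conjTranspose * S.K B).mulVec (x t)))) ∧
        (MinEnergy.energy u : ℂ) = star x₀ ⬝ᵥ (S.K B).mulVec x₀ ∧
        ∀ v, MinEnergy.IsMinimizer A B x₀ v → v =ᵐ[volume.restrict (Ici 0)] u) := by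
  refine ⟨MinEnergy.integrableOn_gramianIntegrand S.re_pos _, S.isUnit_Wu hAB,
    ⟨fun ⟨_, hu⟩ => S.mem_stableSubspace_of_isMinimizer hAB hu,
      fun h => ⟨_, S.isMinimizer_feedback hAB h⟩⟩, fun h => ?_⟩
  refine ⟨_, _, S.isMinimizer_feedback hAB h, MinEnergy.isTrajectory_closedLoop (S.K B) x₀,
    fun t _ => MinEnergy.feedback_apply (S.K B) x₀ t, ?_,
    fun v hv => S.isMinimizer_unique hAB hv⟩
  -- The energy is the real part of the quadratic form, which is real because K is Hermitian.
  rw [MinEnergy.energy_closedLoop (S.conjTranspose_K B) (S.riccati (S.isUnit_Wu hAB)) h,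
    MinEnergy.quadratic_form_im (S.conjTranspose_K B)]
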